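/- Let $m,n\ge 0$ and let $\mathfrak g=\mathfrak{gl}(m|2n)$ over $\mathbb C$, with diagonal Cartan subalgebra $\mathfrak h\cong\mathbb C^{m|2n}$ and dual basis $\epsilon_1,\dots,\epsilon_m,\delta_1,\dots,\delta_{2n}$ of $\mathfrak h^*$. A Borel subalgebra $\mathfrak b\supseteq\mathfrak h$ corresponds to an ordering $\xi_1\xi_2\cdots\xi_{m+2n}$ of the $\epsilon_i,\delta_k$ (its simple roots are the $\xi_i-\xi_{i+1}$); $\mathfrak b$ is \emph{decreasing} if in this sequence the indices of the $\epsilon$s and of the $\delta$s are separately decreasing. The lower triangular Borel subalgebra $\mathfrak b_0$ has sequence $\delta_{2n}\cdots\delta_1\epsilon_m\cdots\epsilon_1$. For decreasing $\mathfrak b$ let $\ell_{i}=\ell_{i,\mathfrak b}$ be the number of $\delta$s to the right of $\epsilon_i$ and $j_k=j_{k,\mathfrak b}$ the number of $\epsilon$s to the left of $\delta_k$; let $\mathfrak b_e$ be the decreasing Borel subalgebra with $\ell_{i,\mathfrak b_e}=2\lfloor \ell_{i,\mathfrak b}/2\rfloor$ for all $i$. Write $\rho_{\mathfrak b}$ for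 the Weyl vector of $\mathfrak b$ (half the sum of the positive even roots minus half the sum of the positive odd roots), and $\rho_0=\rho_{\mathfrak b_0}$. Let $M_0$ be the matrix of the map $\mathfrak h^*\to\mathbb C^{m|n}$, $(a|b)\mapsto-\left(\frac{a_1}2,\dots,\frac{a_m}2\,\Big|\,\frac{b_1+b_2}2,\dots,\frac{b_{2n-1}+b_{2n}}2\right)$, and let $\mathcal C$ be the set of matrices $M_0+(0_{(m+n)\times m}\mid A)$, where the columns of the $(m+n)\times 2n$ complex matrix $A$ satisfy $A_{2k}=-A_{2k-1}$ for $1\le k\le n$. Put $\tau_0(x)=M_0x+X_0$ with $X_0=M_0\rho_0$. Let $T_{\mathfrak b}=\{1\le k\le n: j_{2k}<j_{2k-1}\}$ and, for $k\in T_{\mathfrak b}$, $$r_{odd,\mathfrak b,k}=(j_{2k-1}-j_{2k})\,\delta_{2k-1}-\sum_{i=m-j_{2k-1}+1}^{m-j_{2k}}\epsilon_i ,$$ and let $\mathcal C_{\mathfrak b}=\{M\in\mathcal C: M r_{odd,\mathfrak b,k}=0\ \text{for all }k\in T_{\mathfrak b}\}$. For an $m|n$ hook partition $\lambda$ (an integer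 partition with $\lambda_{m+1}\le n$), let $V_{2\lambda}$ be the irreducible finite-dimensional $\mathfrak g$-module whose highest weight with respect to the upper triangular Borel subalgebra is $\sum_{i=1}^m 2\lambda_i\epsilon_i+\sum_{j=1}^{2n}\max\{(2\lambda)'_j-m,0\}\delta_j$, where $2\lambda$ is the partition with parts $2\lambda_i$ and $'$ denotes transpose. Let $W_\lambda=(V_{2\lambda})^*$, and let $\underline\lambda_0$ and $\underline\lambda_{\mathfrak b}$ be its (unique) highest weights with respect to $\mathfrak b_0$ and to $\mathfrak b$. Call $\lambda$ \emph{$\mathfrak b$-generic} if $\underline\lambda_{\mathfrak b}=\underline\lambda_0-r_{\mathfrak b}$, where $r_{\mathfrak b}=\sum_{i=1}^m\sum_{k=1}^{\ell_i}(\delta_k-\epsilon_i)$, and \emph{compatible} with $\mathfrak b$ if it is $\mathfrak b$-generic or, for each $k\in T_{\mathfrak b}$, either $2\lambda_{m-j_{2k}}>2k-1$ or $2\lambda_{m-j_{2k-1}+1}<2k-1$. Two vectors of $\mathbb C^{m|n}$ are \emph{monoidally equivalent}, written $u\sim v$, if they are related by a finite sequence of separate permutations of the first $m$ and of the last $n$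 coordinates and of exchanges $w+\frac12e_i-\frac12e_{m+j}\leftrightarrow w-\frac12e_i+\frac12e_{m+j}$ with $1\le i\le m$, $1\le j\le n$ and $w_i+\frac12w_{m+j}=0$. \textbf{Proposition.} Let $\mathfrak b$ be a decreasing Borel subalgebra, set $X_{\mathfrak b}=X_{\mathfrak b_e}:=M_0\rho_{\mathfrak b_e}$, and let $M\in\mathcal C_{\mathfrak b}$. Then the affine function $\tau_{\mathfrak b}(x)=Mx+X_{\mathfrak b}$ satisfies $$\tau_{\mathfrak b}(\underline\lambda_{\mathfrak b})\sim\tau_0(\underline\lambda_0)$$ for every $m|n$ hook partition $\lambda$ that is compatible with $\mathfrak b$. -/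

import Mathlib

namespace CapelliGL

open Matrix

/-! ## The Lie superalgebra `gl(m|N)` and its supermodules -/

/-- Parity of the index set of `ℂ^{m|N}`: `Sum.inl i` (even) and `Sum.inr j` (odd). -/
def parity {m N : ℕ} : Fin m ⊕ Fin N → ZMod 2 := Sum.elim (fun _ => 0) (fun _ => 1)

/-- The Koszul sign `(-1)^{pq}`. -/
noncomputable def koszul (p q : ZMod 2) : ℂ := if p = 1 ∧ q = 1 then -1 else 1

/-- The supercommutator `xy - (-1)^{pq} yx` of elements `x`, `y` of parities `p`, `q`. -/
noncomputable def superComm {A : Type*} [Ring A] [Module ℂ A] (p q : ZMod 2) (x y : A) : A :=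
  x * y - koszul p q • (y * x)

/-- The underlying vector space of `gl(m|N)`. -/
abbrev GlMat (m N : ℕ) : Type := Matrix (Fin m ⊕ Fin N) (Fin m ⊕ Fin N) ℂ

/-- The homogeneous part of parity `p` of `gl(m|N)`. -/
def glPart (m N : ℕ) (p : ZMod 2) : Submodule ℂ (GlMat m N) where
  carrier := {x | ∀ i j, parity i + parity j ≠ p → x i j = 0}
  add_mem' := by
    intro x y hx hy i j h
    simp [hx i j h, hy i j h]
  zero_mem' := by
    intro i j _
    rfl
  smul_mem' := by
    intro c x hx i j h
    simp [hx i j h]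

/-- The projection of `gl(m|N)` onto its homogeneous part of parity `p`. -/
def glProj (m N : ℕ) (p : ZMod 2) : GlMat m N →ₗ[ℂ] GlMat m N where
  toFun x := Matrix.of fun i j => if parity i + parity j = p then x i j else 0
  map_add' := by
    intro x y
    ext i j
    by_cases h : parity i + parity j = p <;> simp [h]
  map_smul' := by
    intro c x
    ext i j
    by_cases h : parity i + parity j = p <;> simp [h]

/-- A module over the Lie superalgebra `gl(m|N)` on the vector space `V`: a `ℤ/2`-grading
`V = V₀ ⊕ V₁` and an even linear map `gl(m|N) → End V` which respects the superbrackets. -/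
structure Supermodule (m N : ℕ) (V : Type*) [AddCommGroup V] [Module ℂ V] where
  part : ZMod 2 → Submodule ℂ V
  isCompl : IsCompl (part 0) (part 1)
  act : GlMat m N →ₗ[ℂ] Module.End ℂ V
  act_mem : ∀ (p q : ZMod 2) (x : GlMat m N) (v : V),
    x ∈ glPart m N p → v ∈ part q → act x v ∈ part (p + q)
  act_superComm : ∀ (p q : ZMod 2) (x y : GlMat m N), x ∈ glPart m N p → y ∈ glPart m N q →
    act (superComm p q x y) = superComm p q (act x) (act y)

lemma zmod_two_cases (p : ZMod 2) : p = 0 ∨ p = 1 := by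
  revert p
  decide

lemma glProj_of_mem {m N : ℕ} {p : ZMod 2} {x : GlMat m N} (hx : x ∈ glPart m N p) :
    glProj m N p x = x := by
  ext i j
  by_cases h : parity i + parity j = p
  · simp [glProj, h]
  · simp [glProj, h, hx i j h]

lemma glProj_of_mem_ne {m N : ℕ} {p q : ZMod 2} {x : GlMat m N} (hx : x ∈ glPart m N p)
    (hpq : p ≠ q) : glProj m N q x = 0 := by
  ext i j
  by_cases h : parity i + parity j = q
  · simp [glProj, h, hx i j (by rw [h]; exact hpq.symm)]
  · simp [glProj, h]

lemma parity_mul_mem {m N : ℕ} {p q : ZMod 2} {x y : GlMat m N} (hx : x ∈ glPart m N p)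
    (hy : y ∈ glPart m N q) : x * y ∈ glPart m N (p + q) := by
  intro i j h
  rw [Matrix.mul_apply]
  refine Finset.sum_eq_zero fun k _ => ?_
  by_cases h1 : parity i + parity k = p
  · by_cases h2 : parity k + parity j = q
    · exfalso
      apply h
      rw [← h1, ← h2]
      generalize parity i = a
      generalize parity j = b
      generalize parity k = c
      revert a b c
      decide
    · simp [hy k j h2]
  · simp [hx i k h1]

lemma superComm_mem {m N : ℕ} {p q : ZMod 2} {x y : GlMat m N} (hx : x ∈ glPart m N p)
    (hy : y ∈ glPart m N q) : superComm p q x y ∈ glPart m N (p + q) :=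
  Submodule.sub_mem _ (parity_mul_mem hx hy)
    (Submodule.smul_mem _ _ (add_comm q p ▸ parity_mul_mem hy hx))

namespace Supermodule

variable {m N : ℕ} {V : Type*} [AddCommGroup V] [Module ℂ V]

/-- The parity operator `v ↦ (-1)^{|v|} v`. -/
noncomputable def parityOp (ρ : Supermodule m N V) : Module.End ℂ V :=
  (ρ.part 0).projection (ρ.part 1) ρ.isCompl - (ρ.part 1).projection (ρ.part 0) ρ.isCompl.symm

lemma parityOp_zero (ρ : Supermodule m N V) {v : V} (hv : v ∈ ρ.part 0) :
    ρ.parityOp v = v := by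
  have h1 : (ρ.part 1).projection (ρ.part 0) ρ.isCompl.symm v = 0 :=
    (Submodule.projection_apply_eq_zero_iff _).2 hv
  simp [parityOp, Submodule.projection_apply_of_mem_left _ hv, h1]

lemma parityOp_one (ρ : Supermodule m N V) {v : V} (hv : v ∈ ρ.part 1) :
    ρ.parityOp v = -v := by
  have h1 : (ρ.part 0).projection (ρ.part 1) ρ.isCompl v = 0 :=
    (Submodule.projection_apply_eq_zero_iff _).2 hv
  simp [parityOp, Submodule.projection_apply_of_mem_left _ hv, h1]

lemma exists_parts (ρ : Supermodule m N V) (v : V) :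
    ∃ a ∈ ρ.part 0, ∃ b ∈ ρ.part 1, v = a + b := by
  have h : v ∈ ρ.part 0 ⊔ ρ.part 1 := by rw [ρ.isCompl.sup_eq_top]; trivial
  obtain ⟨a, ha, b, hb, h⟩ := Submodule.mem_sup.1 h
  exact ⟨a, ha, b, hb, h.symm⟩

lemma parityOp_parityOp (ρ : Supermodule m N V) (v : V) : ρ.parityOp (ρ.parityOp v) = v := by
  obtain ⟨a, ha, b, hb, rfl⟩ := ρ.exists_parts v
  simp [ρ.parityOp_zero ha, ρ.parityOp_one hb]

lemma parityOp_act_even (ρ : Supermodule m N V) {x : GlMat m N} (hx : x ∈ glPart m N 0) (v : V) :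
    ρ.parityOp (ρ.act x v) = ρ.act x (ρ.parityOp v) := by
  obtain ⟨a, ha, b, hb, rfl⟩ := ρ.exists_parts v
  have h0 : ρ.act x a ∈ ρ.part 0 := by simpa using ρ.act_mem 0 0 x a hx ha
  have h1 : ρ.act x b ∈ ρ.part 1 := by simpa using ρ.act_mem 0 1 x b hx hb
  simp [ρ.parityOp_zero ha, ρ.parityOp_one hb, ρ.parityOp_zero h0, ρ.parityOp_one h1]

lemma parityOp_act_odd (ρ : Supermodule m N V) {x : GlMat m N} (hx : x ∈ glPart m N 1) (v : V) :
    ρ.parityOp (ρ.act x v) = -ρ.act x (ρ.parityOp v) := by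
  obtain ⟨a, ha, b, hb, rfl⟩ := ρ.exists_parts v
  have h0 : ρ.act x a ∈ ρ.part 1 := by simpa using ρ.act_mem 1 0 x a hx ha
  have h1 : ρ.act x b ∈ ρ.part 0 := ρ.act_mem 1 1 x b hx hb
  simp [ρ.parityOp_zero ha, ρ.parityOp_one hb, ρ.parityOp_zero h1, ρ.parityOp_one h0]
  abel

/-- The action on the dual space; on homogeneous elements it is
`(x f)(v) = -(-1)^{|x||f|} f(x v)`, see `dualAct_apply`. -/
noncomputable def dualAct (ρ : Supermodule m N V) :
    GlMat m N →ₗ[ℂ] Module.End ℂ (Module.Dual ℂ V) where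
  toFun x := -((ρ.act (glProj m N 0 x)).dualMap +
    (ρ.act (glProj m N 1 x)).dualMap ∘ₗ ρ.parityOp.dualMap)
  map_add' := by
    intro x y
    ext f v
    simp
    ring
  map_smul' := by
    intro c x
    ext f v
    simp

lemma dualAct_even (ρ : Supermodule m N V) {x : GlMat m N} (hx : x ∈ glPart m N 0)
    (f : Module.Dual ℂ V) (v : V) : ρ.dualAct x f v = -f (ρ.act x v) := by
  simp [dualAct, glProj_of_mem hx, glProj_of_mem_ne hx (by decide : (0 : ZMod 2) ≠ 1)]

lemma dualAct_odd (ρ : Supermodule m N V) {x : GlMat m N} (hx : x ∈ glPart m N 1)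
    (f : Module.Dual ℂ V) (v : V) : ρ.dualAct x f v = -f (ρ.parityOp (ρ.act x v)) := by
  simp [dualAct, glProj_of_mem hx, glProj_of_mem_ne hx (by decide : (1 : ZMod 2) ≠ 0)]

lemma dualAct_apply (ρ : Supermodule m N V) {p q : ZMod 2} {x : GlMat m N} (hx : x ∈ glPart m N p)
    {f : Module.Dual ℂ V} (hf : ∀ v ∈ ρ.part (q + 1), f v = 0) (v : V) :
    ρ.dualAct x f v = -(koszul p q * f (ρ.act x v)) := by
  rcases zmod_two_cases p with rfl | rfl
  · simp [ρ.dualAct_even hx, koszul]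
  · rw [ρ.dualAct_odd hx]
    obtain ⟨a, ha, b, hb, hab⟩ := ρ.exists_parts (ρ.act x v)
    rw [hab]
    rcases zmod_two_cases q with rfl | rfl
    · have hb' : f b = 0 := hf b (by simpa using hb)
      simp [ρ.parityOp_zero ha, ρ.parityOp_one hb, koszul, hb']
    · have ha' : f a = 0 := hf a ha
      simp [ρ.parityOp_zero ha, ρ.parityOp_one hb, koszul, ha']

/-- The dual (contragredient) supermodule `V^*`. -/
noncomputable def dual (ρ : Supermodule m N V) : Supermodule m N (Module.Dual ℂ V) where
  part p := (ρ.part (p + 1)).dualAnnihilator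
  isCompl := by
    have h := Subspace.isCompl_dualAnnihilator ρ.isCompl.symm
    exact h
  act := ρ.dualAct
  act_mem := by
    intro p q x f hx hf
    rw [Submodule.mem_dualAnnihilator] at hf ⊢
    intro v hv
    rw [ρ.dualAct_apply hx hf, hf (ρ.act x v), mul_zero, neg_zero]
    have h := ρ.act_mem p _ x v hx hv
    have h2 : p + (p + q + 1) = q + 1 := by
      clear h hv hf hx
      revert p q
      decide
    rwa [h2] at h
  act_superComm := by
    intro p q x y hx hy
    have hxy := superComm_mem hx hy
    have hact := ρ.act_superComm p q x y hx hy
    ext f v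
    rcases zmod_two_cases p with rfl | rfl <;> rcases zmod_two_cases q with rfl | rfl
    · rw [ρ.dualAct_even hxy, hact]
      simp [superComm, koszul, ρ.dualAct_even hx, ρ.dualAct_even hy]
    · rw [ρ.dualAct_odd hxy, hact]
      simp [superComm, koszul, ρ.dualAct_even hx, ρ.dualAct_odd hy, ρ.parityOp_act_even hx]
    · rw [ρ.dualAct_odd hxy, hact]
      simp [superComm, koszul, ρ.dualAct_odd hx, ρ.dualAct_even hy, ρ.parityOp_act_even hy]
    · rw [ρ.dualAct_even hxy, hact]
      simp [superComm, koszul, ρ.dualAct_odd hx, ρ.dualAct_odd hy, ρ.parityOp_act_odd hx,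
        ρ.parityOp_act_odd hy, ρ.parityOp_parityOp]

/-- Irreducibility: `V ≠ 0`, and the only graded submodules are `0` and `V`. -/
def IsIrreducible (ρ : Supermodule m N V) : Prop :=
  Nontrivial V ∧ ∀ U : Submodule ℂ V,
    U ≤ (U ⊓ ρ.part 0) ⊔ (U ⊓ ρ.part 1) → (∀ x, ∀ u ∈ U, ρ.act x u ∈ U) → U = ⊥ ∨ U = ⊤

end Supermodule

/-! ## Borel subalgebras and `δε`-sequences -/

/-- A `δε`-sequence: an ordering of the symbols `ε₁,…,ε_m` (`Sum.inl`) and `δ₁,…,δ_N`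
(`Sum.inr`); `pos` is the position in the sequence, from left to right. -/
structure DESeq (m N : ℕ) where
  pos : Fin m ⊕ Fin N ≃ Fin (m + N)

namespace DESeq

variable {m N : ℕ}

/-- The Borel subalgebra whose simple roots are the differences `ξ_i - ξ_{i+1}` of consecutive
terms of the sequence. It is spanned by the matrix units `E_{pq}` (of weight `ξ_p - ξ_q`) with
`p = q` or `p` to the left of `q`. -/
def borel (b : DESeq m N) : Submodule ℂ (GlMat m N) where
  carrier := {x | ∀ p q, b.pos q < b.pos p → x p q = 0}
  add_mem' := by
    intro x y hx hy i j h
    simp [hx i j h, hy i j h]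
  zero_mem' := by
    intro i j _
    rfl
  smul_mem' := by
    intro c x hx i j h
    simp [hx i j h]

/-- The sequence `ε₁ ⋯ ε_m δ₁ ⋯ δ_N` of the upper triangular Borel subalgebra. -/
def standard (m N : ℕ) : DESeq m N := ⟨finSumFinEquiv⟩

/-- The sequence `δ_N ⋯ δ₁ ε_m ⋯ ε₁` of the lower triangular Borel subalgebra. -/
def opposite (m N : ℕ) : DESeq m N := ⟨finSumFinEquiv.trans Fin.revPerm⟩

/-- The indices of the `ε`s and of the `δ`s are separately decreasing. -/
def IsDecreasing (b : DESeq m N) : Prop :=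
  (∀ i i' : Fin m, i < i' → b.pos (Sum.inl i') < b.pos (Sum.inl i)) ∧
  (∀ k k' : Fin N, k < k' → b.pos (Sum.inr k') < b.pos (Sum.inr k))

/-- `ℓ_{i,b}`: the number of `δ`s to the right of `ε_i`. -/
def ell (b : DESeq m N) (i : Fin m) : ℕ :=
  (Finset.univ.filter fun k : Fin N => b.pos (Sum.inl i) < b.pos (Sum.inr k)).card

/-- `j_{k,b}`: the number of `ε`s to the left of `δ_k`. -/
def jay (b : DESeq m N) (k : Fin N) : ℕ :=
  (Finset.univ.filter fun i : Fin m => b.pos (Sum.inl i) < b.pos (Sum.inr k)).card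

/-- `r_b`: the sum of the roots `δ_k - ε_i` with `k ≤ ℓ_{i,b}` (the index `k : Fin N` stands for
`k + 1`). Weights are written in coordinates with respect to the basis `ε_i`, `δ_k`. -/
noncomputable def r (b : DESeq m N) : Fin m ⊕ Fin N → ℂ :=
  ∑ i : Fin m, ∑ k ∈ Finset.univ.filter (fun k : Fin N => (k : ℕ) < b.ell i),
    (Pi.single (Sum.inr k) 1 - Pi.single (Sum.inl i) 1)

/-- The Weyl vector: half the sum of the positive even roots minus half the sum of the positive
odd roots. -/
noncomputable def weyl (b : DESeq m N) : Fin m ⊕ Fin N → ℂ :=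
  (1 / 2 : ℂ) • ∑ p, ∑ q ∈ Finset.univ.filter (fun q => b.pos p < b.pos q),
    (if parity p = parity q then (1 : ℂ) else -1) • (Pi.single p 1 - Pi.single q 1)

lemma ell_le (b : DESeq m N) (i : Fin m) : b.ell i ≤ N := by
  simpa [ell] using Finset.card_le_univ
    (Finset.univ.filter fun k : Fin N => b.pos (Sum.inl i) < b.pos (Sum.inr k))

lemma IsDecreasing.ell_mono {b : DESeq m N} (hb : b.IsDecreasing) : Monotone b.ell := by
  intro i i' h
  refine Finset.card_le_card ?_
  intro k hk
  simp only [Finset.mem_filter, Finset.mem_univ, true_and] at hk ⊢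
  rcases h.eq_or_lt with rfl | h
  · exact hk
  · exact (hb.1 i i' h).trans hk

lemma card_fin_lt (n l : ℕ) (h : l ≤ n) :
    (Finset.univ.filter fun k : Fin n => (k : ℕ) < l).card = l := by
  rw [Fin.card_filter_val_lt]
  omega

lemma count_le (l : Fin m → ℕ) (c : ℕ) :
    (Finset.univ.filter fun i : Fin m => c < l i).card ≤ m := by
  simpa using Finset.card_le_univ (Finset.univ.filter fun i : Fin m => c < l i)

lemma count_anti (l : Fin m → ℕ) {c c' : ℕ} (h : c ≤ c') :
    (Finset.univ.filter fun i : Fin m => c' < l i).card ≤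
      (Finset.univ.filter fun i : Fin m => c < l i).card := by
  refine Finset.card_le_card fun i => ?_
  simp only [Finset.mem_filter, Finset.mem_univ, true_and]
  omega

lemma count_of_lt {l : Fin m → ℕ} (hl : Monotone l) {i : Fin m} {c : ℕ} (h : c < l i) :
    m - i ≤ (Finset.univ.filter fun i : Fin m => c < l i).card := by
  rw [← Fin.card_Ici i]
  refine Finset.card_le_card fun i' hi' => ?_
  simp only [Finset.mem_filter, Finset.mem_univ, true_and]
  exact h.trans_le (hl (Finset.mem_Ici.1 hi'))

lemma count_of_le {l : Fin m → ℕ} (hl : Monotone l) {i : Fin m} {c : ℕ} (h : l i ≤ c) :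
    (Finset.univ.filter fun i : Fin m => c < l i).card ≤ m - 1 - i := by
  rw [← Fin.card_Ioi i]
  refine Finset.card_le_card fun i' hi' => ?_
  simp only [Finset.mem_filter, Finset.mem_univ, true_and] at hi'
  rw [Finset.mem_Ioi]
  by_contra hc
  exact absurd (hl (not_lt.1 hc)) (by omega)

/-- Position, in the decreasing sequence with given values `ℓ_i`, of each symbol. -/
def posOf (l : Fin m → ℕ) : Fin m ⊕ Fin N → ℕ :=
  Sum.elim (fun i => (m - 1 - i) + (N - l i))
    (fun k => (N - 1 - k) + (Finset.univ.filter fun i : Fin m => (k : ℕ) < l i).card)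

lemma posOf_inl_lt {l : Fin m → ℕ} (hl : Monotone l) {i i' : Fin m}
    (h : i < i') : posOf (N := N) l (Sum.inl i') < posOf (N := N) l (Sum.inl i) := by
  have h1 := hl h.le
  have h2 : (i : ℕ) < i' := h
  have h3 := i'.2
  simp only [posOf, Sum.elim_inl]
  omega

lemma posOf_inr_lt (l : Fin m → ℕ) {k k' : Fin N}
    (h : k < k') : posOf l (Sum.inr k') < posOf l (Sum.inr k) := by
  have h2 : (k : ℕ) < k' := h
  have h1 := count_anti l h2.le
  have h3 := k'.2
  simp only [posOf, Sum.elim_inr]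
  omega

lemma posOf_inl_lt_inr {l : Fin m → ℕ} (hl : Monotone l) (hN : ∀ i, l i ≤ N) {i : Fin m}
    {k : Fin N} (h : (k : ℕ) < l i) :
    posOf (N := N) l (Sum.inl i) < posOf l (Sum.inr k) := by
  have h1 := count_of_lt hl h
  have h2 := i.2
  have h3 := k.2
  have h4 := hN i
  simp only [posOf, Sum.elim_inr, Sum.elim_inl]
  omega

lemma posOf_inr_lt_inl {l : Fin m → ℕ} (hl : Monotone l) {i : Fin m}
    {k : Fin N} (h : l i ≤ k) :
    posOf l (Sum.inr k) < posOf (N := N) l (Sum.inl i) := by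
  have h1 := count_of_le hl h
  have h2 := i.2
  have h3 := k.2
  simp only [posOf, Sum.elim_inr, Sum.elim_inl]
  omega

lemma posOf_injective {l : Fin m → ℕ} (hl : Monotone l) (hN : ∀ i, l i ≤ N) :
    Function.Injective (posOf (N := N) l) := by
  rintro (i | k) (i' | k') h
  · rcases lt_trichotomy i i' with h' | h' | h'
    · exact absurd h (posOf_inl_lt hl h').ne'
    · rw [h']
    · exact absurd h (posOf_inl_lt hl h').ne
  · rcases lt_or_ge (k' : ℕ) (l i) with h' | h'
    · exact absurd h (posOf_inl_lt_inr hl hN h').ne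
    · exact absurd h (posOf_inr_lt_inl hl h').ne'
  · rcases lt_or_ge (k : ℕ) (l i') with h' | h'
    · exact absurd h (posOf_inl_lt_inr hl hN h').ne'
    · exact absurd h (posOf_inr_lt_inl hl h').ne
  · rcases lt_trichotomy k k' with h' | h' | h'
    · exact absurd h (posOf_inr_lt l h').ne'
    · rw [h']
    · exact absurd h (posOf_inr_lt l h').ne

lemma posOf_lt (l : Fin m → ℕ) (p : Fin m ⊕ Fin N) : posOf l p < m + N := by
  rcases p with i | k
  · have := i.2
    simp only [posOf, Sum.elim_inl]
    omega
  · have := k.2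
    have := count_le l k
    simp only [posOf, Sum.elim_inr]
    omega

/-- The decreasing `δε`-sequence with given values `ℓ_1 ≤ ⋯ ≤ ℓ_m ≤ N`. -/
noncomputable def ofEll (l : Fin m → ℕ) (hl : Monotone l) (hN : ∀ i, l i ≤ N) : DESeq m N where
  pos := Equiv.ofBijective (fun p => (⟨posOf l p, posOf_lt l p⟩ : Fin (m + N))) <|
    (Fintype.bijective_iff_injective_and_card _).2
      ⟨fun _ _ h => posOf_injective hl hN (congrArg Fin.val h), by simp⟩

lemma ofEll_isDecreasing (l : Fin m → ℕ) (hl : Monotone l) (hN : ∀ i, l i ≤ N) :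
    (ofEll l hl hN).IsDecreasing :=
  ⟨fun _ _ h => posOf_inl_lt hl h, fun _ _ h => posOf_inr_lt l h⟩

lemma ell_ofEll (l : Fin m → ℕ) (hl : Monotone l) (hN : ∀ i, l i ≤ N) :
    (ofEll l hl hN).ell = l := by
  funext i
  rw [← card_fin_lt N (l i) (hN i)]
  unfold ell
  congr 1
  ext k
  simp only [Finset.mem_filter, Finset.mem_univ, true_and]
  constructor
  · intro h
    by_contra h'
    exact absurd (show posOf l (Sum.inl i) < posOf l (Sum.inr k) from h)
      (posOf_inr_lt_inl hl (not_lt.1 h')).le.not_gt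
  · exact fun h => posOf_inl_lt_inr hl hN h

/-- `b_e`: the decreasing sequence with `ℓ_{i,b_e} = 2⌊ℓ_{i,b}/2⌋`. -/
noncomputable def evenPart (b : DESeq m N) (hb : b.IsDecreasing) : DESeq m N :=
  ofEll (fun i => 2 * (b.ell i / 2))
    (fun _ _ h => Nat.mul_le_mul_left 2 (Nat.div_le_div_right (hb.ell_mono h)))
    (fun i => (Nat.mul_div_le _ 2).trans (b.ell_le i))

end DESeq

/-- `ν` is a highest weight of the supermodule with respect to the Borel subalgebra `b`: some
nonzero vector is an eigenvector of `b`, on which the diagonal part of `x ∈ b` acts by `ν` and the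
nilradical acts by zero. -/
def Supermodule.IsHighestWeight {m N : ℕ} {V : Type*} [AddCommGroup V] [Module ℂ V]
    (ρ : Supermodule m N V) (b : DESeq m N) (ν : Fin m ⊕ Fin N → ℂ) : Prop :=
  ∃ v : V, v ≠ 0 ∧ ∀ x ∈ b.borel, ρ.act x v = (∑ p, ν p * x p p) • v

/-! ## Hook partitions. Partitions are Young diagrams; `rowLen i` is the part `i + 1`. -/

/-- `lam` is an `m|n` hook partition: `lam_{m+1} ≤ n`. -/
def IsHook (m n : ℕ) (lam : YoungDiagram) : Prop := lam.rowLen m ≤ n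

/-- The partition `2 lam`, obtained by doubling each part. -/
def doubled (lam : YoungDiagram) : YoungDiagram where
  cells := lam.cells.biUnion fun c => {(c.1, 2 * c.2), (c.1, 2 * c.2 + 1)}
  isLowerSet := by
    have key : ∀ a b : ℕ, (a, b) ∈ (↑(lam.cells.biUnion fun c =>
        ({(c.1, 2 * c.2), (c.1, 2 * c.2 + 1)} : Finset (ℕ × ℕ))) : Set (ℕ × ℕ)) ↔
        (a, b / 2) ∈ lam.cells := by
      intro a b
      simp only [Finset.coe_biUnion, Set.mem_iUnion, Finset.coe_insert, Finset.coe_singleton,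
        Set.mem_insert_iff, Set.mem_singleton_iff, Prod.mk.injEq, Finset.mem_coe]
      constructor
      · rintro ⟨⟨c, d⟩, hc, ⟨rfl, rfl⟩ | ⟨rfl, rfl⟩⟩
        · simpa using hc
        · have : (2 * d + 1) / 2 = d := by omega
          simpa [this] using hc
      · intro h
        refine ⟨(a, b / 2), h, ?_⟩
        simp only [true_and]
        omega
    rintro ⟨a, b⟩ ⟨a', b'⟩ h hab
    rw [key] at hab ⊢
    exact lam.isLowerSet (show (a', b' / 2) ≤ (a, b / 2) from
      ⟨h.1, Nat.div_le_div_right h.2⟩) hab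

lemma mem_doubled {lam : YoungDiagram} {a b : ℕ} : (a, b) ∈ doubled lam ↔ (a, b / 2) ∈ lam := by
  rw [← YoungDiagram.mem_cells, ← YoungDiagram.mem_cells]
  simp only [doubled, Finset.mem_biUnion, Finset.mem_insert, Finset.mem_singleton, Prod.mk.injEq]
  constructor
  · rintro ⟨⟨c, d⟩, hc, ⟨rfl, rfl⟩ | ⟨rfl, rfl⟩⟩
    · simpa using hc
    · have : (2 * d + 1) / 2 = d := by omega
      simpa [this] using hc
  · intro h
    refine ⟨(a, b / 2), h, ?_⟩
    simp only [true_and]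
    omega

lemma rowLen_doubled (lam : YoungDiagram) (i : ℕ) :
    (doubled lam).rowLen i = 2 * lam.rowLen i := by
  refine eq_of_forall_lt_iff fun c => ?_
  rw [← YoungDiagram.mem_iff_lt_rowLen, mem_doubled, YoungDiagram.mem_iff_lt_rowLen]
  omega

/-- `∑ κ_i ε_i + ∑ max(κ'_j - m, 0) δ_j`, the highest weight with respect to the upper triangular
Borel subalgebra of the irreducible `gl(m|N)`-module `V_κ` (truncated subtraction is meant). -/
def hookWeight (m N : ℕ) (κ : YoungDiagram) : Fin m ⊕ Fin N → ℂ :=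
  Sum.elim (fun i => (κ.rowLen i : ℂ)) (fun j => ((κ.colLen j - m : ℕ) : ℂ))

/-! ## Monoidal equivalence on `ℂ^{m|n}` -/

/-- One separate symmetry, or one monoidal symmetry
`w + e_i/2 - e_{m+j}/2 → w - e_i/2 + e_{m+j}/2` where `w` lies on the hyperplane
`x_i + θ y_j = 0`. -/
inductive SymmetryStep {m n : ℕ} (θ : ℂ) : (Fin m ⊕ Fin n → ℂ) → (Fin m ⊕ Fin n → ℂ) → Prop
  | separate (u : Fin m ⊕ Fin n → ℂ) (σ : Equiv.Perm (Fin m)) (τ : Equiv.Perm (Fin n)) :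
      SymmetryStep θ u (u ∘ Sum.map σ τ)
  | monoidal (w : Fin m ⊕ Fin n → ℂ) (i : Fin m) (j : Fin n)
      (hw : w (Sum.inl i) + θ * w (Sum.inr j) = 0) :
      SymmetryStep θ
        (w + Pi.single (Sum.inl i) (1 / 2) - Pi.single (Sum.inr j) (1 / 2))
        (w - Pi.single (Sum.inl i) (1 / 2) + Pi.single (Sum.inr j) (1 / 2))

/-- `u ∼ v`: related by a sequence of separate and monoidal symmetries. -/
def MonoidallyEquivalent {m n : ℕ} (θ : ℂ) (u v : Fin m ⊕ Fin n → ℂ) : Prop :=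
  Relation.EqvGen (SymmetryStep θ) u v

/-! ## The affine maps. The index `k : Fin n` stands for `k + 1`, so that `δ_{2k-1}` and `δ_{2k}`
become `dOdd k` and `dEven k`. -/

/-- The index of `δ_{2k-1}`. -/
def dOdd {n : ℕ} (k : Fin n) : Fin (2 * n) := ⟨2 * k, by omega⟩

/-- The index of `δ_{2k}`. -/
def dEven {n : ℕ} (k : Fin n) : Fin (2 * n) := ⟨2 * k + 1, by omega⟩

/-- The matrix `M₀` of the linear map
`(a | b) ↦ -(a₁/2, …, a_m/2 | (b₁+b₂)/2, …, (b_{2n-1}+b_{2n})/2)`. -/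
noncomputable def M₀ (m n : ℕ) : Matrix (Fin m ⊕ Fin n) (Fin m ⊕ Fin (2 * n)) ℂ :=
  Matrix.fromBlocks ((-(1 / 2) : ℂ) • 1) 0 0
    (Matrix.of fun k j => if j = dOdd k ∨ j = dEven k then -(1 / 2) else 0)

/-- The set `𝒞` of matrices `M₀ + (0 | A)` whose columns satisfy `A_{2k} = -A_{2k-1}`. -/
def setC (m n : ℕ) : Set (Matrix (Fin m ⊕ Fin n) (Fin m ⊕ Fin (2 * n)) ℂ) :=
  {M | ∃ A : Matrix (Fin m ⊕ Fin n) (Fin (2 * n)) ℂ,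
    (∀ s k, A s (dEven k) = -A s (dOdd k)) ∧ M = M₀ m n + Matrix.fromCols 0 A}

/-- The map `τ₀(x) = M₀ x + X₀` with `X₀ = M₀ ρ₀`, where `ρ₀` is the Weyl vector of the lower
triangular Borel subalgebra. -/
noncomputable def tau₀ (m n : ℕ) (x : Fin m ⊕ Fin (2 * n) → ℂ) : Fin m ⊕ Fin n → ℂ :=
  M₀ m n *ᵥ x + M₀ m n *ᵥ (DESeq.opposite m (2 * n)).weyl

namespace DESeq

variable {m n : ℕ}

/-- `T_b`: the indices `k` with `j_{2k,b} < j_{2k-1,b}`. -/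
def T (b : DESeq m (2 * n)) : Set (Fin n) := {k | b.jay (dEven k) < b.jay (dOdd k)}

/-- `r_{odd,b,k} = (j_{2k-1} - j_{2k}) δ_{2k-1} - ∑_{i = m - j_{2k-1} + 1}^{m - j_{2k}} ε_i`. -/
noncomputable def rOdd (b : DESeq m (2 * n)) (k : Fin n) : Fin m ⊕ Fin (2 * n) → ℂ :=
  ((b.jay (dOdd k) : ℂ) - (b.jay (dEven k) : ℂ)) • Pi.single (Sum.inr (dOdd k)) 1 -
    ∑ i ∈ Finset.univ.filter
      (fun i : Fin m => m - b.jay (dOdd k) + 1 ≤ (i : ℕ) + 1 ∧ (i : ℕ) + 1 ≤ m - b.jay (dEven k)),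
      Pi.single (Sum.inl i) 1

/-- The set `𝒞_b`. -/
def setC (b : DESeq m (2 * n)) : Set (Matrix (Fin m ⊕ Fin n) (Fin m ⊕ Fin (2 * n)) ℂ) :=
  {M | M ∈ CapelliGL.setC m n ∧ ∀ k ∈ b.T, M *ᵥ b.rOdd k = 0}

/-- `τ_b(x) = M x + X_b`, where `X_b = X_{b_e} = M₀ ρ_{b_e}`. -/
noncomputable def tau (b : DESeq m (2 * n)) (hb : b.IsDecreasing)
    (M : Matrix (Fin m ⊕ Fin n) (Fin m ⊕ Fin (2 * n)) ℂ) (x : Fin m ⊕ Fin (2 * n) → ℂ) :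
    Fin m ⊕ Fin n → ℂ :=
  M *ᵥ x + M₀ m n *ᵥ (b.evenPart hb).weyl

/-- `lam` is compatible with `b`, where `ν₀` and `ν` are the highest weights of `W_lam` with respect
to the lower triangular Borel subalgebra and to `b`. Either `lam` is `b`-generic, that is
`ν = ν₀ - r_b`, or for each `k ∈ T_b` one has `2 lam_{m - j_{2k}} > 2k - 1` or
`2 lam_{m - j_{2k-1} + 1} < 2k - 1`. (The part `lam_s` is `lam.rowLen (s - 1)`, and `k : Fin n`
stands for `k + 1`.) -/
def IsCompatible (b : DESeq m (2 * n)) (lam : YoungDiagram) (ν₀ ν : Fin m ⊕ Fin (2 * n) → ℂ) :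
    Prop :=
  ν = ν₀ - b.r ∨ ∀ k ∈ b.T,
    2 * (k : ℕ) + 1 < 2 * lam.rowLen (m - b.jay (dEven k) - 1) ∨
      2 * lam.rowLen (m - b.jay (dOdd k)) < 2 * (k : ℕ) + 1

end DESeq

end CapelliGL

namespace CapelliGL

open Matrix

section Units

variable {m N : ℕ}

/-- The matrix unit `E_{pq}` of `gl(m|N)`. -/
def matUnit (p q : Fin m ⊕ Fin N) : GlMat m N := Matrix.single p q 1

lemma matUnit_mem (p q : Fin m ⊕ Fin N) : matUnit p q ∈ glPart m N (parity p + parity q) := by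
  intro i j h
  rw [matUnit, Matrix.single_apply, if_neg]
  rintro ⟨rfl, rfl⟩
  exact h rfl

lemma diagonal_mem (d : Fin m ⊕ Fin N → ℂ) : Matrix.diagonal d ∈ glPart m N 0 := by
  intro i j h
  refine Matrix.diagonal_apply_ne _ ?_
  rintro rfl
  exact h (CharTwo.add_self_eq_zero _)

lemma matUnit_mul (p q r s : Fin m ⊕ Fin N) :
    matUnit p q * matUnit r s = if q = r then matUnit p s else 0 := by
  split_ifs with h
  · subst h
    simp [matUnit]
  · simp [matUnit, h]

lemma sum_matUnit (x : GlMat m N) : x = ∑ p, ∑ q, x p q • matUnit p q := by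
  conv_lhs => rw [Matrix.matrix_eq_sum_single x]
  simp [matUnit, Matrix.smul_single]

lemma diagonal_eq_sum (d : Fin m ⊕ Fin N → ℂ) :
    (Matrix.diagonal d : GlMat m N) = ∑ p, d p • matUnit p p := by
  conv_lhs => rw [sum_matUnit (Matrix.diagonal d)]
  refine Finset.sum_congr rfl fun p _ => ?_
  rw [Finset.sum_eq_single p]
  · simp
  · intro q _ hq
    simp [Matrix.diagonal_apply_ne _ hq.symm]
  · simp

end Units

namespace Supermodule

variable {m N : ℕ} {V : Type*} [AddCommGroup V] [Module ℂ V]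

lemma act_eq_sum (ρ : Supermodule m N V) (x : GlMat m N) (v : V) :
    ρ.act x v = ∑ p, ∑ q, x p q • ρ.act (matUnit p q) v := by
  conv_lhs => rw [sum_matUnit x]
  simp

lemma act_diagonal (ρ : Supermodule m N V) (d : Fin m ⊕ Fin N → ℂ) (v : V) :
    ρ.act (Matrix.diagonal d) v = ∑ p, d p • ρ.act (matUnit p p) v := by
  rw [diagonal_eq_sum]
  simp

lemma act_matUnit_matUnit (ρ : Supermodule m N V) (p q r s : Fin m ⊕ Fin N) (v : V) :
    ρ.act (matUnit p q) (ρ.act (matUnit r s) v) =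
      koszul (parity p + parity q) (parity r + parity s) •
        ρ.act (matUnit r s) (ρ.act (matUnit p q) v) +
      ((if q = r then ρ.act (matUnit p s) v else 0) -
      koszul (parity p + parity q) (parity r + parity s) •
        (if s = p then ρ.act (matUnit r q) v else 0)) := by
  have h := congrArg (fun f : Module.End ℂ V => f v)
    (ρ.act_superComm _ _ _ _ (matUnit_mem p q) (matUnit_mem r s))
  simp only [superComm, matUnit_mul, map_sub, map_smul, LinearMap.sub_apply, LinearMap.smul_apply,
    Module.End.mul_apply] at h
  rw [sub_eq_iff_eq_add] at h
  have h1 : (ρ.act (if q = r then matUnit p s else 0)) v =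
      if q = r then ρ.act (matUnit p s) v else 0 := by split_ifs <;> simp
  have h2 : (ρ.act (if s = p then matUnit r q else 0)) v =
      if s = p then ρ.act (matUnit r q) v else 0 := by split_ifs <;> simp
  rw [h1, h2] at h
  rw [h]
  abel

lemma act_diagonal_matUnit (ρ : Supermodule m N V) (d : Fin m ⊕ Fin N → ℂ)
    (p q : Fin m ⊕ Fin N) (v : V) :
    ρ.act (Matrix.diagonal d) (ρ.act (matUnit p q) v) =
      ρ.act (matUnit p q) (ρ.act (Matrix.diagonal d) v) + (d p - d q) • ρ.act (matUnit p q) v := by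
  have h := congrArg (fun f : Module.End ℂ V => f v)
    (ρ.act_superComm _ _ _ _ (diagonal_mem d) (matUnit_mem p q))
  have h2 : superComm 0 (parity p + parity q) (Matrix.diagonal d) (matUnit p q) =
      (d p - d q) • matUnit p q := by
    ext i j
    simp only [superComm, koszul, matUnit, Matrix.sub_apply, Matrix.smul_apply,
      Matrix.diagonal_mul, Matrix.mul_diagonal, Matrix.single_apply, smul_eq_mul]
    by_cases hij : p = i ∧ q = j
    · obtain ⟨rfl, rfl⟩ := hij
      simp
    · simp [hij]
  rw [h2] at h
  simp only [superComm, koszul, map_smul, LinearMap.smul_apply, LinearMap.sub_apply,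
    Module.End.mul_apply] at h
  rw [h]
  simp

/-- `v` is a highest weight vector of weight `ν` with respect to `b`, in terms of matrix units. -/
structure IsHWVector (ρ : Supermodule m N V) (b : DESeq m N) (ν : Fin m ⊕ Fin N → ℂ) (v : V) :
    Prop where
  ne_zero : v ≠ 0
  weight : ∀ p, ρ.act (matUnit p p) v = ν p • v
  nil : ∀ p q, b.pos p < b.pos q → ρ.act (matUnit p q) v = 0

lemma isHighestWeight_iff (ρ : Supermodule m N V) (b : DESeq m N) (ν : Fin m ⊕ Fin N → ℂ) :
    ρ.IsHighestWeight b ν ↔ ∃ v, ρ.IsHWVector b ν v := by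
  constructor
  · rintro ⟨v, hv, h⟩
    refine ⟨v, hv, fun p => ?_, fun p q hpq => ?_⟩
    · rw [h]
      · congr 1
        simp [matUnit, Matrix.single_apply]
      · intro p' q' hlt
        rw [matUnit, Matrix.single_apply, if_neg]
        rintro ⟨rfl, rfl⟩
        exact lt_irrefl _ hlt
    · rw [h]
      · rw [Finset.sum_eq_zero, zero_smul]
        intro r _
        rw [matUnit, Matrix.single_apply, if_neg, mul_zero]
        rintro ⟨rfl, rfl⟩
        exact lt_irrefl _ hpq
      · intro p' q' hlt
        rw [matUnit, Matrix.single_apply, if_neg]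
        rintro ⟨rfl, rfl⟩
        exact lt_asymm hlt hpq
  · rintro ⟨v, hv⟩
    refine ⟨v, hv.ne_zero, fun x hx => ?_⟩
    rw [act_eq_sum, Finset.sum_smul]
    refine Finset.sum_congr rfl fun p _ => ?_
    rw [Finset.sum_eq_single p]
    · rw [hv.weight, smul_smul, mul_comm]
    · intro q _ hq
      rcases lt_trichotomy (b.pos p) (b.pos q) with h | h | h
      · rw [hv.nil p q h, smul_zero]
      · exact absurd (b.pos.injective h).symm hq
      · rw [hx p q h, zero_smul]
    · simp

lemma parityOp_act_matUnit (ρ : Supermodule m N V) (p q : Fin m ⊕ Fin N) (v : V) :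
    ρ.parityOp (ρ.act (matUnit p q) v) = ρ.act (matUnit p q) (ρ.parityOp v) ∨
    ρ.parityOp (ρ.act (matUnit p q) v) = -ρ.act (matUnit p q) (ρ.parityOp v) := by
  have h := matUnit_mem p q
  rcases zmod_two_cases (parity p + parity q) with h0 | h0
  · exact Or.inl (ρ.parityOp_act_even (h0 ▸ h) v)
  · exact Or.inr (ρ.parityOp_act_odd (h0 ▸ h) v)

lemma parityOp_act_matUnit_self (ρ : Supermodule m N V) (p : Fin m ⊕ Fin N) (v : V) :
    ρ.parityOp (ρ.act (matUnit p p) v) = ρ.act (matUnit p p) (ρ.parityOp v) := by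
  have h := matUnit_mem p p
  rw [CharTwo.add_self_eq_zero] at h
  exact ρ.parityOp_act_even h v

lemma mem_part_zero_iff (ρ : Supermodule m N V) (v : V) : v ∈ ρ.part 0 ↔ ρ.parityOp v = v := by
  refine ⟨ρ.parityOp_zero, fun h => ?_⟩
  obtain ⟨a, ha, b, hb, rfl⟩ := ρ.exists_parts v
  rw [map_add, ρ.parityOp_zero ha, ρ.parityOp_one hb, add_right_inj] at h
  have : b = 0 := by
    have h2 : (2 : ℂ) • b = 0 := by rw [two_smul]; nth_rewrite 1 [← h]; exact neg_add_cancel b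
    simpa using h2
  simpa [this] using ha

lemma mem_part_one_iff (ρ : Supermodule m N V) (v : V) : v ∈ ρ.part 1 ↔ ρ.parityOp v = -v := by
  refine ⟨ρ.parityOp_one, fun h => ?_⟩
  obtain ⟨a, ha, b, hb, rfl⟩ := ρ.exists_parts v
  rw [map_add, ρ.parityOp_zero ha, ρ.parityOp_one hb, neg_add, add_left_inj] at h
  have : a = 0 := by
    have h2 : (2 : ℂ) • a = 0 := by rw [two_smul]; nth_rewrite 1 [h]; exact neg_add_cancel a
    simpa using h2
  simpa [this] using hb

/-- Submodules stable under the parity operator are graded. -/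
lemma le_of_parityOp_stable (ρ : Supermodule m N V) {U : Submodule ℂ V}
    (hU : ∀ u ∈ U, ρ.parityOp u ∈ U) : U ≤ (U ⊓ ρ.part 0) ⊔ (U ⊓ ρ.part 1) := by
  intro u hu
  have h0 : (1 / 2 : ℂ) • (u + ρ.parityOp u) ∈ U ⊓ ρ.part 0 := by
    refine ⟨U.smul_mem _ (U.add_mem hu (hU u hu)), ?_⟩
    rw [SetLike.mem_coe, mem_part_zero_iff, map_smul, map_add, parityOp_parityOp, add_comm]
  have h1 : (1 / 2 : ℂ) • (u - ρ.parityOp u) ∈ U ⊓ ρ.part 1 := by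
    refine ⟨U.smul_mem _ (U.sub_mem hu (hU u hu)), ?_⟩
    rw [SetLike.mem_coe, mem_part_one_iff, map_smul, map_sub, parityOp_parityOp, ← smul_neg,
      neg_sub]
  refine Submodule.mem_sup.2 ⟨_, h0, _, h1, ?_⟩
  rw [← smul_add, add_add_sub_cancel, ← two_smul ℂ u, smul_smul]
  norm_num

lemma IsHWVector.exists_homogeneous {ρ : Supermodule m N V} {b : DESeq m N}
    {ν : Fin m ⊕ Fin N → ℂ} {v : V} (hv : ρ.IsHWVector b ν v) :
    ∃ w, ρ.IsHWVector b ν w ∧ (ρ.parityOp w = w ∨ ρ.parityOp w = -w) := by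
  have hP : ∀ p q, b.pos p < b.pos q → ρ.act (matUnit p q) (ρ.parityOp v) = 0 := by
    intro p q hpq
    rcases ρ.parityOp_act_matUnit p q v with h | h
    · rw [← h, hv.nil p q hpq, map_zero]
    · rw [← neg_eq_zero, ← h, hv.nil p q hpq, map_zero]
  by_cases h0 : v + ρ.parityOp v = 0
  · exact ⟨v, hv, Or.inr (eq_neg_of_add_eq_zero_right h0)⟩
  · refine ⟨v + ρ.parityOp v, ⟨h0, fun p => ?_, fun p q hpq => ?_⟩, Or.inl ?_⟩
    · rw [map_add, ← parityOp_act_matUnit_self, hv.weight, map_smul, smul_add]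
    · rw [map_add, hv.nil p q hpq, hP p q hpq, add_zero]
    · rw [map_add, parityOp_parityOp, add_comm]

/-- A submodule of an irreducible supermodule is everything if it contains a homogeneous highest
weight vector and is stable under the negative root vectors. -/
lemma IsIrreducible.eq_top_of_stable {ρ : Supermodule m N V} (hρ : ρ.IsIrreducible)
    {b : DESeq m N} {ν : Fin m ⊕ Fin N → ℂ} {v : V} (hv : ρ.IsHWVector b ν v)
    (hom : ρ.parityOp v = v ∨ ρ.parityOp v = -v) (W : Submodule ℂ V) (hvW : v ∈ W)
    (hW : ∀ p q, b.pos q < b.pos p → ∀ w ∈ W, ρ.act (matUnit p q) w ∈ W) : W = ⊤ := by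
  set S : Set (Submodule ℂ V) :=
    {W | v ∈ W ∧ ∀ p q, b.pos q < b.pos p → ∀ w ∈ W, ρ.act (matUnit p q) w ∈ W} with hS
  set U : Submodule ℂ V := sInf S with hUdef
  have hUmin : ∀ W ∈ S, U ≤ W := fun W hW => sInf_le hW
  have hUS : U ∈ S := by
    refine ⟨Submodule.mem_sInf.2 fun W hW => hW.1, fun p q hpq w hw => Submodule.mem_sInf.2
      fun W hW => hW.2 p q hpq w (hUmin W hW hw)⟩
  have hact : ∀ u ∈ U, ∀ p q, ρ.act (matUnit p q) u ∈ U := by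
    let W : Submodule ℂ V :=
      { carrier := {u | u ∈ U ∧ ∀ p q, ρ.act (matUnit p q) u ∈ U}
        add_mem' := fun ha hb => ⟨U.add_mem ha.1 hb.1, fun p q => by
          rw [map_add]; exact U.add_mem (ha.2 p q) (hb.2 p q)⟩
        zero_mem' := ⟨U.zero_mem, fun p q => by rw [map_zero]; exact U.zero_mem⟩
        smul_mem' := fun c u hu => ⟨U.smul_mem c hu.1, fun p q => by
          rw [map_smul]; exact U.smul_mem c (hu.2 p q)⟩ }
    have hWS : W ∈ S := by
      refine ⟨⟨hUS.1, fun p q => ?_⟩, fun p q hpq w hw => ⟨hw.2 p q, fun r s => ?_⟩⟩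
      · rcases lt_trichotomy (b.pos p) (b.pos q) with h | h | h
        · rw [hv.nil p q h]
          exact U.zero_mem
        · obtain rfl := b.pos.injective h
          rw [hv.weight]
          exact U.smul_mem _ hUS.1
        · exact hUS.2 p q h v hUS.1
      · rw [act_matUnit_matUnit]
        refine U.add_mem (U.smul_mem _ (hUS.2 p q hpq _ (hw.2 r s))) (U.sub_mem ?_
          (U.smul_mem _ ?_))
        · split_ifs
          · exact hw.2 _ _
          · exact U.zero_mem
        · split_ifs
          · exact hw.2 _ _
          · exact U.zero_mem
    exact fun u hu => (hUmin W hWS hu).2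
  have hpar : ∀ u ∈ U, ρ.parityOp u ∈ U := by
    have hWS : U.comap ρ.parityOp ∈ S := by
      refine ⟨?_, fun p q hpq w hw => ?_⟩
      · rw [Submodule.mem_comap]
        rcases hom with h | h <;> rw [h]
        · exact hUS.1
        · exact U.neg_mem hUS.1
      · rw [Submodule.mem_comap] at hw ⊢
        rcases ρ.parityOp_act_matUnit p q w with h | h <;> rw [h]
        · exact hUS.2 p q hpq _ hw
        · exact U.neg_mem (hUS.2 p q hpq _ hw)
    exact fun u hu => hUmin _ hWS hu
  have htop : U = ⊤ := by
    refine (hρ.2 U (ρ.le_of_parityOp_stable hpar) fun x u hu => ?_).resolve_left ?_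
    · rw [act_eq_sum]
      exact U.sum_mem fun p _ => U.sum_mem fun q _ => U.smul_mem _ (hact u hu p q)
    · intro h
      exact hv.ne_zero (by simpa [h] using hUS.1)
  exact top_unique (htop ▸ hUmin W ⟨hvW, hW⟩)

/-- The diagonal matrix whose entries are the positions in the sequence. -/
noncomputable def grading (ρ : Supermodule m N V) (b : DESeq m N) : Module.End ℂ V :=
  ρ.act (Matrix.diagonal fun p => ((b.pos p : ℕ) : ℂ))

/-- The sum of the eigenspaces of the grading element with eigenvalues `c + 1, c + 2, …`. -/
noncomputable def beyond (ρ : Supermodule m N V) (b : DESeq m N) (c : ℂ) : Submodule ℂ V :=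
  ⨆ k : ℕ, (ρ.grading b).eigenspace (c + (k + 1 : ℕ))

lemma act_mem_eigenspace (ρ : Supermodule m N V) (b : DESeq m N) (p q : Fin m ⊕ Fin N) {c : ℂ}
    {v : V} (hv : v ∈ (ρ.grading b).eigenspace c) :
    ρ.act (matUnit p q) v ∈
      (ρ.grading b).eigenspace (c + ((b.pos p : ℕ) - (b.pos q : ℕ) : ℂ)) := by
  rw [Module.End.mem_eigenspace_iff] at hv ⊢
  unfold grading at hv ⊢
  rw [act_diagonal_matUnit, hv, map_smul, add_smul]

lemma act_mem_eigenspace_of_lt (ρ : Supermodule m N V) (b : DESeq m N) {p q : Fin m ⊕ Fin N}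
    (hpq : b.pos q < b.pos p) {c : ℂ} {v : V} (k : ℕ)
    (hv : v ∈ (ρ.grading b).eigenspace (c + k)) :
    ρ.act (matUnit p q) v ∈ ρ.beyond b c := by
  have h := ρ.act_mem_eigenspace b p q hv
  obtain ⟨d, hd⟩ := Nat.exists_eq_add_of_lt (show (b.pos q : ℕ) < b.pos p from hpq)
  refine Submodule.mem_iSup_of_mem (k + d) ?_
  convert h using 2
  rw [hd]
  push_cast
  ring

lemma act_mem_beyond (ρ : Supermodule m N V) (b : DESeq m N) {p q : Fin m ⊕ Fin N}
    (hpq : b.pos q ≤ b.pos p) {c : ℂ} {v : V} (hv : v ∈ ρ.beyond b c) :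
    ρ.act (matUnit p q) v ∈ ρ.beyond b c := by
  refine Submodule.iSup_induction _ (motive := fun v => ρ.act (matUnit p q) v ∈ ρ.beyond b c) hv
    (fun k v hv => ?_) (by rw [map_zero]; exact Submodule.zero_mem _)
    (fun v w hv hw => by rw [map_add]; exact Submodule.add_mem _ hv hw)
  rcases hpq.lt_or_eq with h | h
  · exact ρ.act_mem_eigenspace_of_lt b h _ hv
  · have h' := ρ.act_mem_eigenspace b p q hv
    rw [h, sub_self, add_zero] at h'
    exact Submodule.mem_iSup_of_mem k h'

lemma parityOp_mem_beyond (ρ : Supermodule m N V) (b : DESeq m N) {c : ℂ} {v : V}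
    (hv : v ∈ ρ.beyond b c) : ρ.parityOp v ∈ ρ.beyond b c := by
  refine Submodule.iSup_induction _ (motive := fun v => ρ.parityOp v ∈ ρ.beyond b c) hv
    (fun k v hv => ?_) (by rw [map_zero]; exact Submodule.zero_mem _)
    (fun v w hv hw => by rw [map_add]; exact Submodule.add_mem _ hv hw)
  refine Submodule.mem_iSup_of_mem k ?_
  rw [Module.End.mem_eigenspace_iff] at hv ⊢
  unfold grading at hv ⊢
  rw [← parityOp_act_even _ (diagonal_mem _), hv, map_smul]

lemma IsHWVector.mem_eigenspace {ρ : Supermodule m N V} {b : DESeq m N}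
    {ν : Fin m ⊕ Fin N → ℂ} {v : V} (hv : ρ.IsHWVector b ν v) :
    v ∈ (ρ.grading b).eigenspace (∑ p, ((b.pos p : ℕ) : ℂ) * ν p) := by
  rw [Module.End.mem_eigenspace_iff, grading, act_diagonal, Finset.sum_smul]
  exact Finset.sum_congr rfl fun p _ => by rw [hv.weight, smul_smul]

lemma eq_zero_of_mem_beyond (ρ : Supermodule m N V) (b : DESeq m N) {c : ℂ} {v : V}
    (hv : v ∈ (ρ.grading b).eigenspace c) (hv' : v ∈ ρ.beyond b c) : v = 0 := by
  have h := (Module.End.eigenspaces_iSupIndep (ρ.grading b)) c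
  refine Submodule.disjoint_def.1 h v hv ?_
  refine (iSup_le fun k => ?_ : ρ.beyond b c ≤ _) hv'
  refine le_iSup₂_of_le (c + (k + 1 : ℕ)) ?_ le_rfl
  intro h
  rw [add_eq_left] at h
  exact absurd h (Nat.cast_ne_zero.2 (Nat.succ_ne_zero k))

lemma IsIrreducible.span_sup_beyond {ρ : Supermodule m N V} (hρ : ρ.IsIrreducible)
    {b : DESeq m N} {ν : Fin m ⊕ Fin N → ℂ} {v : V} (hv : ρ.IsHWVector b ν v)
    (hom : ρ.parityOp v = v ∨ ρ.parityOp v = -v) :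
    Submodule.span ℂ {v} ⊔ ρ.beyond b (∑ p, ((b.pos p : ℕ) : ℂ) * ν p) = ⊤ := by
  refine hρ.eq_top_of_stable hv hom _
    (Submodule.mem_sup_left (Submodule.mem_span_singleton_self v)) fun p q hpq w hw => ?_
  obtain ⟨a, ha, u, hu, rfl⟩ := Submodule.mem_sup.1 hw
  obtain ⟨c, rfl⟩ := Submodule.mem_span_singleton.1 ha
  refine Submodule.mem_sup_right ?_
  rw [map_add, map_smul]
  refine Submodule.add_mem _ (Submodule.smul_mem _ _ ?_) (ρ.act_mem_beyond b hpq.le hu)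
  exact ρ.act_mem_eigenspace_of_lt b hpq 0 (by simpa using hv.mem_eigenspace)

lemma IsIrreducible.exists_eigenvalue_add {ρ : Supermodule m N V} (hρ : ρ.IsIrreducible)
    {b : DESeq m N} {ν : Fin m ⊕ Fin N → ℂ} {v : V} (hv : ρ.IsHWVector b ν v)
    (hom : ρ.parityOp v = v ∨ ρ.parityOp v = -v) {c : ℂ} {w : V} (hw0 : w ≠ 0)
    (hw : w ∈ (ρ.grading b).eigenspace c) :
    ∃ k : ℕ, c = (∑ p, ((b.pos p : ℕ) : ℂ) * ν p) + k := by
  by_contra! hc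
  refine hw0 (Submodule.disjoint_def.1 (Module.End.eigenspaces_iSupIndep (ρ.grading b) c) w hw ?_)
  have hwt : w ∈ Submodule.span ℂ {v} ⊔ ρ.beyond b (∑ p, ((b.pos p : ℕ) : ℂ) * ν p) := by
    rw [hρ.span_sup_beyond hv hom]
    trivial
  revert hwt
  apply SetLike.le_def.1
  refine sup_le ((Submodule.span_singleton_le_iff_mem _ _).2 ?_) (iSup_le fun k => ?_)
  · refine Submodule.mem_iSup_of_mem _ (Submodule.mem_iSup_of_mem ?_ hv.mem_eigenspace)
    simpa using (hc 0).symm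
  · exact le_iSup₂_of_le _ (hc (k + 1)).symm le_rfl

/-- Uniqueness of highest weights of irreducible supermodules. -/
lemma IsIrreducible.highestWeight_unique {ρ : Supermodule m N V} (hρ : ρ.IsIrreducible)
    {b : DESeq m N} {ν ν' : Fin m ⊕ Fin N → ℂ} {v w : V} (hv : ρ.IsHWVector b ν v)
    (hw : ρ.IsHWVector b ν' w) : ν' = ν := by
  obtain ⟨v, hv, hv1⟩ := hv.exists_homogeneous
  obtain ⟨w, hw, hw1⟩ := hw.exists_homogeneous
  obtain ⟨k, hk⟩ := hρ.exists_eigenvalue_add hv hv1 hw.ne_zero hw.mem_eigenspace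
  obtain ⟨l, hl⟩ := hρ.exists_eigenvalue_add hw hw1 hv.ne_zero hv.mem_eigenspace
  have hc : (∑ p, ((b.pos p : ℕ) : ℂ) * ν' p) = ∑ p, ((b.pos p : ℕ) : ℂ) * ν p := by
    rw [hk, add_assoc, left_eq_add, ← Nat.cast_add, Nat.cast_eq_zero] at hl
    rw [hk, show k = 0 by omega, Nat.cast_zero, add_zero]
  have hwt : w ∈ Submodule.span ℂ {v} ⊔ ρ.beyond b (∑ p, ((b.pos p : ℕ) : ℂ) * ν p) := by
    rw [hρ.span_sup_beyond hv hv1]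
    trivial
  obtain ⟨a, ha, u, hu, hau⟩ := Submodule.mem_sup.1 hwt
  obtain ⟨c, rfl⟩ := Submodule.mem_span_singleton.1 ha
  have hu0 : u = 0 := by
    refine ρ.eq_zero_of_mem_beyond b ?_ hu
    rw [← add_sub_cancel_left (c • v) u, hau]
    exact Submodule.sub_mem _ (hc ▸ hw.mem_eigenspace) (Submodule.smul_mem _ _ hv.mem_eigenspace)
  rw [hu0, add_zero] at hau
  funext p
  have h := hw.weight p
  have h2 : ρ.act (matUnit p p) w = ν p • w := by
    rw [← hau, map_smul, hv.weight, smul_comm]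
  rw [h2] at h
  exact (smul_left_injective ℂ hw.ne_zero h).symm

/-- The dual of a finite-dimensional irreducible supermodule is irreducible. -/
lemma IsIrreducible.dual [FiniteDimensional ℂ V] {ρ : Supermodule m N V} (hρ : ρ.IsIrreducible) :
    ρ.dual.IsIrreducible := by
  have := hρ.1
  refine ⟨inferInstance, fun U hU hact => ?_⟩
  have hpar : ∀ v ∈ U.dualCoannihilator, ρ.parityOp v ∈ U.dualCoannihilator := by
    intro v hv
    rw [Submodule.mem_dualCoannihilator] at hv ⊢
    intro f hf
    obtain ⟨f0, hf0, f1, hf1, rfl⟩ := Submodule.mem_sup.1 (hU hf)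
    have h0 : ∀ u ∈ ρ.part 1, f0 u = 0 := (Submodule.mem_dualAnnihilator _).1 hf0.2
    have h1 : ∀ u ∈ ρ.part 0, f1 u = 0 := (Submodule.mem_dualAnnihilator _).1 hf1.2
    have hv0 := hv f0 hf0.1
    have hv1 := hv f1 hf1.1
    obtain ⟨a, ha, c, hc, rfl⟩ := ρ.exists_parts v
    rw [map_add, h0 c hc, add_zero] at hv0
    rw [map_add, h1 a ha, zero_add] at hv1
    simp [ρ.parityOp_zero ha, ρ.parityOp_one hc, h0 c hc, h1 a ha, hv0, hv1]
  have hcoact : ∀ x, ∀ v ∈ U.dualCoannihilator, ρ.act x v ∈ U.dualCoannihilator := by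
    intro x v hv
    rw [act_eq_sum]
    refine Submodule.sum_mem _ fun p _ => Submodule.sum_mem _ fun q _ =>
      Submodule.smul_mem _ _ ?_
    have hv' := hpar v hv
    rw [Submodule.mem_dualCoannihilator] at hv hv' ⊢
    intro f hf
    have hf' := hact (matUnit p q) f hf
    have hm := matUnit_mem p q
    rcases zmod_two_cases (parity p + parity q) with h0 | h0 <;> rw [h0] at hm
    · have h2 := hv _ hf'
      change ρ.dualAct _ f v = 0 at h2
      rwa [ρ.dualAct_even hm, neg_eq_zero] at h2
    · have h2 := hv' _ hf'
      change ρ.dualAct _ f _ = 0 at h2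
      rwa [ρ.dualAct_odd hm, ρ.parityOp_act_odd hm, parityOp_parityOp, map_neg, neg_neg] at h2
  rcases hρ.2 _ (ρ.le_of_parityOp_stable hpar) hcoact with h | h
  · right
    rw [← Subspace.dualCoannihilator_dualAnnihilator_eq (W := U), h,
      Submodule.dualAnnihilator_bot]
  · left
    rw [← Subspace.dualCoannihilator_dualAnnihilator_eq (W := U), h,
      Submodule.dualAnnihilator_top]

/-- The highest weight of the dual with respect to the opposite order. -/
lemma IsIrreducible.exists_dual_hwVector {ρ : Supermodule m N V} (hρ : ρ.IsIrreducible)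
    {b b' : DESeq m N} (hbb' : ∀ p q, b'.pos p < b'.pos q ↔ b.pos q < b.pos p)
    {ν : Fin m ⊕ Fin N → ℂ} (hν : ρ.IsHighestWeight b ν) :
    ∃ f, ρ.dual.IsHWVector b' (-ν) f := by
  obtain ⟨v, hv⟩ := (ρ.isHighestWeight_iff b ν).1 hν
  obtain ⟨v, hv, hom⟩ := hv.exists_homogeneous
  set c := ∑ p, ((b.pos p : ℕ) : ℂ) * ν p with hc
  have hvn : v ∉ ρ.beyond b c := fun h =>
    hv.ne_zero (ρ.eq_zero_of_mem_beyond b hv.mem_eigenspace h)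
  obtain ⟨f, hfv, hf⟩ := Submodule.exists_le_ker_of_notMem hvn
  have hf0 : ∀ u ∈ ρ.beyond b c, f u = 0 := fun u hu => hf hu
  have hdec : ∀ u : V, ∃ (a : ℂ) (w : V), w ∈ ρ.beyond b c ∧ u = a • v + w := by
    intro u
    have hu : u ∈ Submodule.span ℂ {v} ⊔ ρ.beyond b c := by
      rw [hρ.span_sup_beyond hv hom]
      trivial
    obtain ⟨a, ha, w, hw, rfl⟩ := Submodule.mem_sup.1 hu
    obtain ⟨a, rfl⟩ := Submodule.mem_span_singleton.1 ha
    exact ⟨a, w, hw, rfl⟩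
  refine ⟨f, fun h => hfv (by rw [h]; rfl), fun p => ?_, fun p q hpq => ?_⟩
  · ext u
    have hm := matUnit_mem p p
    rw [CharTwo.add_self_eq_zero] at hm
    change ρ.dualAct _ f u = _
    rw [ρ.dualAct_even hm]
    obtain ⟨a, w, hw, rfl⟩ := hdec u
    simp [hv.weight, hf0 _ hw, hf0 _ (ρ.act_mem_beyond b (le_refl (b.pos p)) hw)]
    ring
  · rw [hbb'] at hpq
    have hmem : ∀ u, ρ.act (matUnit p q) u ∈ ρ.beyond b c := by
      intro u
      obtain ⟨a, w, hw, rfl⟩ := hdec u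
      rw [map_add, map_smul]
      exact Submodule.add_mem _ (Submodule.smul_mem _ _
        (ρ.act_mem_eigenspace_of_lt b hpq 0 (by simpa only [Nat.cast_zero, add_zero] using hv.mem_eigenspace)))
        (ρ.act_mem_beyond b hpq.le hw)
    ext u
    change ρ.dualAct _ f u = 0
    have hm := matUnit_mem p q
    rcases zmod_two_cases (parity p + parity q) with h0 | h0 <;> rw [h0] at hm
    · rw [ρ.dualAct_even hm, hf0 _ (hmem u), neg_zero]
    · rw [ρ.dualAct_odd hm, hf0 _ (ρ.parityOp_mem_beyond b (hmem u)), neg_zero]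

/-- `b'` is obtained from `b` by exchanging `ξ_s ξ_t` to `ξ_t ξ_s`. -/
def _root_.CapelliGL.DESeq.Flip (b b' : DESeq m N) (s t : Fin m ⊕ Fin N) : Prop :=
  b.pos s < b.pos t ∧
  ∀ p q, b'.pos p < b'.pos q ↔ (b.pos p < b.pos q ∧ ¬(p = s ∧ q = t)) ∨ (p = t ∧ q = s)

/-- Odd reflections: the highest weight vector after a flip. -/
lemma IsIrreducible.oddReflection {ρ : Supermodule m N V} (hρ : ρ.IsIrreducible)
    {b b' : DESeq m N} {s t : Fin m ⊕ Fin N} (hodd : parity s + parity t = 1)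
    (hflip : b.Flip b' s t) {ν : Fin m ⊕ Fin N → ℂ} {v : V} (hv : ρ.IsHWVector b ν v) :
    ∃ w, ρ.IsHWVector b' (if ν s + ν t = 0 then ν else ν - (Pi.single s 1 - Pi.single t 1)) w := by
  obtain ⟨hst, hiff⟩ := hflip
  have hne : s ≠ t := by
    rintro rfl
    exact lt_irrefl _ hst
  have hodd' : parity t + parity s = 1 := by rw [add_comm, hodd]
  have hts : b'.pos t < b'.pos s := (hiff t s).2 (Or.inr ⟨rfl, rfl⟩)
  have hkk : koszul 1 1 = -1 := by simp [koszul]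
  set w := ρ.act (matUnit t s) v with hw
  have hwt : ∀ p, ρ.act (matUnit p p) w = (ν - (Pi.single s 1 - Pi.single t 1) : _ → ℂ) p • w := by
    intro p
    have h1 := ρ.act_diagonal_matUnit (Pi.single p 1) t s v
    have h2 : ∀ u, ρ.act (Matrix.diagonal (Pi.single p 1)) u = ρ.act (matUnit p p) u := by
      intro u
      rw [act_diagonal, Finset.sum_eq_single p]
      · simp
      · intro q _ hq
        simp [Pi.single_eq_of_ne hq]
      · simp
    rw [h2, h2, hv.weight, map_smul, ← add_smul] at h1
    rw [hw, h1]
    congr 1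
    simp only [Pi.sub_apply, Pi.single_apply, eq_comm (a := p)]
    ring
  have hnil : ∀ p q, b.pos p < b.pos q → ¬(p = s ∧ q = t) → ρ.act (matUnit p q) w = 0 := by
    intro p q hpq hn
    have hpq' : b'.pos p < b'.pos q := (hiff p q).2 (Or.inl ⟨hpq, hn⟩)
    rw [hw, act_matUnit_matUnit, hv.nil p q hpq, map_zero, smul_zero, zero_add]
    have e1 : (if q = t then ρ.act (matUnit p s) v else 0) = 0 := by
      split_ifs with h
      · subst h
        rcases (hiff p s).1 (hpq'.trans hts) with h | h
        · exact hv.nil p s h.1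
        · exact absurd h.1 (by rintro rfl; exact lt_irrefl _ hpq)
      · rfl
    have e2 : (if s = p then ρ.act (matUnit t q) v else 0) = 0 := by
      split_ifs with h
      · subst h
        rcases (hiff t q).1 (hts.trans hpq') with h | h
        · exact hv.nil t q h.1
        · exact absurd h.2 (by rintro rfl; exact lt_irrefl _ hpq)
      · rfl
    rw [e1, e2, smul_zero, sub_zero]
  have hst_w : ρ.act (matUnit s t) w = (ν s + ν t) • v := by
    rw [hw, act_matUnit_matUnit, hv.nil s t hst, hodd, hodd', hkk]
    simp [hv.weight, add_smul]
  have hts_w : ρ.act (matUnit t s) w = 0 := by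
    have h := ρ.act_matUnit_matUnit t s t s v
    rw [if_neg hne, hodd', hkk, smul_zero, sub_zero, add_zero, neg_one_smul,
      ← hw] at h
    have h2 : (2 : ℂ) • ρ.act (matUnit t s) w = 0 := by
      rw [two_smul]
      nth_rewrite 1 [h]
      exact neg_add_cancel _
    simpa using h2
  split_ifs with h0
  · have hw0 : w = 0 := by
      by_contra hne0
      have hwv : ρ.IsHWVector b (ν - (Pi.single s 1 - Pi.single t 1)) w := by
        refine ⟨hne0, hwt, fun p q hpq => ?_⟩
        by_cases hc : p = s ∧ q = t
        · rw [hc.1, hc.2, hst_w, h0, zero_smul]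
        · exact hnil p q hpq hc
      have h := congrFun (hρ.highestWeight_unique hv hwv) s
      simp [Pi.single_eq_of_ne hne] at h
    refine ⟨v, hv.ne_zero, hv.weight, fun p q hpq => ?_⟩
    rcases (hiff p q).1 hpq with h | ⟨rfl, rfl⟩
    · exact hv.nil p q h.1
    · exact hw0
  · refine ⟨w, ?_, hwt, fun p q hpq => ?_⟩
    · intro hw0
      rw [hw0, map_zero] at hst_w
      exact smul_ne_zero h0 hv.ne_zero hst_w.symm
    · rcases (hiff p q).1 hpq with h | ⟨rfl, rfl⟩
      · exact hnil p q h.1 h.2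
      · exact hts_w

end Supermodule

end CapelliGL

namespace CapelliGL

namespace DESeq

variable {m N : ℕ}

lemma IsDecreasing.inl_lt_inr {b : DESeq m N} (hb : b.IsDecreasing) (i : Fin m) (k : Fin N) :
    b.pos (Sum.inl i) < b.pos (Sum.inr k) ↔ (k : ℕ) < b.ell i := by
  constructor
  · intro h
    have : Finset.Iic k ⊆
        Finset.univ.filter fun k : Fin N => b.pos (Sum.inl i) < b.pos (Sum.inr k) := by
      intro k' hk'
      simp only [Finset.mem_filter, Finset.mem_univ, true_and]
      rcases (Finset.mem_Iic.1 hk').eq_or_lt with rfl | h'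
      · exact h
      · exact h.trans (hb.2 k' k h')
    have := Finset.card_le_card this
    rw [Fin.card_Iic] at this
    exact this
  · intro h
    by_contra hn
    have : (Finset.univ.filter fun k : Fin N => b.pos (Sum.inl i) < b.pos (Sum.inr k)) ⊆
        Finset.Iio k := by
      intro k' hk'
      simp only [Finset.mem_filter, Finset.mem_univ, true_and] at hk'
      rw [Finset.mem_Iio]
      by_contra hc
      rcases (not_lt.1 hc).eq_or_lt with rfl | h'
      · exact hn hk'
      · exact hn (hk'.trans (hb.2 k k' h'))
    have := Finset.card_le_card this
    rw [Fin.card_Iio] at this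
    exact absurd h this.not_gt

lemma IsDecreasing.inr_lt_inl {b : DESeq m N} (hb : b.IsDecreasing) (i : Fin m) (k : Fin N) :
    b.pos (Sum.inr k) < b.pos (Sum.inl i) ↔ ¬(k : ℕ) < b.ell i := by
  rw [← hb.inl_lt_inr, not_lt]
  exact ⟨le_of_lt, fun h => lt_of_le_of_ne h (by simp)⟩

lemma IsDecreasing.inl_lt_inl {b : DESeq m N} (hb : b.IsDecreasing) (i i' : Fin m) :
    b.pos (Sum.inl i) < b.pos (Sum.inl i') ↔ i' < i := by
  refine ⟨fun h => ?_, hb.1 i' i⟩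
  by_contra hc
  rcases (not_lt.1 hc).eq_or_lt with rfl | h'
  · exact lt_irrefl _ h
  · exact lt_asymm h (hb.1 _ _ h')

lemma IsDecreasing.inr_lt_inr {b : DESeq m N} (hb : b.IsDecreasing) (k k' : Fin N) :
    b.pos (Sum.inr k) < b.pos (Sum.inr k') ↔ k' < k := by
  refine ⟨fun h => ?_, hb.2 k' k⟩
  by_contra hc
  rcases (not_lt.1 hc).eq_or_lt with rfl | h'
  · exact lt_irrefl _ h
  · exact lt_asymm h (hb.2 _ _ h')

lemma IsDecreasing.jay_eq {b : DESeq m N} (hb : b.IsDecreasing) (k : Fin N) :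
    b.jay k = (Finset.univ.filter fun i : Fin m => (k : ℕ) < b.ell i).card := by
  simp only [jay, hb.inl_lt_inr]

lemma IsDecreasing.jay_le {b : DESeq m N} (hb : b.IsDecreasing) (k : Fin N) : b.jay k ≤ m :=
  hb.jay_eq k ▸ count_le b.ell k

/-- A monotone `l` exceeds `c` exactly at the last indices. -/
lemma sub_count_le_iff {l : Fin m → ℕ} (hl : Monotone l) (i : Fin m) (c : ℕ) :
    m - (Finset.univ.filter fun i : Fin m => c < l i).card ≤ i ↔ c < l i := by
  have hi := i.2
  constructor
  · intro h
    by_contra hn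
    have := count_of_le hl (not_lt.1 hn)
    omega
  · intro h
    have := count_of_lt hl h
    omega

lemma opposite_isDecreasing : (opposite m N).IsDecreasing := by
  constructor
  · intro i i' h
    simp only [opposite, Equiv.trans_apply, Fin.revPerm_apply, Fin.rev_lt_rev,
      finSumFinEquiv_apply_left]
    exact h
  · intro i i' h
    simp only [opposite, Equiv.trans_apply, Fin.revPerm_apply, Fin.rev_lt_rev,
      finSumFinEquiv_apply_right]
    exact (Fin.natAdd_lt_natAdd_iff m).2 h

lemma opposite_pos_lt (p q : Fin m ⊕ Fin N) :
    (opposite m N).pos p < (opposite m N).pos q ↔ (standard m N).pos q < (standard m N).pos p := by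
  simp [opposite, standard]

lemma ell_opposite : (opposite m N).ell = 0 := by
  funext i
  simp only [ell, Pi.zero_apply, Finset.card_eq_zero, Finset.filter_eq_empty_iff, Finset.mem_univ,
    true_implies, opposite_pos_lt]
  intro k h
  simp only [standard, finSumFinEquiv_apply_left, finSumFinEquiv_apply_right, Fin.lt_def,
    Fin.val_natAdd, Fin.val_castAdd] at h
  omega

lemma IsDecreasing.pos_lt_iff {b b' : DESeq m N} (hb : b.IsDecreasing) (hb' : b'.IsDecreasing)
    (h : b.ell = b'.ell) (p q : Fin m ⊕ Fin N) :
    b.pos p < b.pos q ↔ b'.pos p < b'.pos q := by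
  rcases p with i | k <;> rcases q with i' | k'
  · rw [hb.inl_lt_inl, hb'.inl_lt_inl]
  · rw [hb.inl_lt_inr, hb'.inl_lt_inr, h]
  · rw [hb.inr_lt_inl, hb'.inr_lt_inl, h]
  · rw [hb.inr_lt_inr, hb'.inr_lt_inr]

lemma IsDecreasing.flip {b b' : DESeq m N} (hb : b.IsDecreasing) (hb' : b'.IsDecreasing)
    {i : Fin m} {k : Fin N} (hk : b.ell i = k) (h : b'.ell = Function.update b.ell i (k + 1)) :
    b.Flip b' (Sum.inr k) (Sum.inl i) := by
  refine ⟨by rw [hb.inr_lt_inl]; omega, fun p q => ?_⟩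
  rcases p with i' | k' <;> rcases q with i'' | k''
  · simp [hb.inl_lt_inl, hb'.inl_lt_inl]
  · simp only [hb.inl_lt_inr, hb'.inl_lt_inr, h, reduceCtorEq, false_and, not_false_eq_true,
      and_true, Sum.inl.injEq, Sum.inr.injEq]
    by_cases hi : i' = i
    · subst hi
      rw [Function.update_self, hk, Fin.ext_iff]
      omega
    · simp [hi]
  · simp only [hb.inr_lt_inl, hb'.inr_lt_inl, h, reduceCtorEq, false_and, or_false,
      Sum.inl.injEq, Sum.inr.injEq]
    by_cases hi : i'' = i
    · subst hi
      rw [Function.update_self, hk, Fin.ext_iff]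
      omega
    · simp [hi]
  · simp [hb.inr_lt_inr, hb'.inr_lt_inr]

end DESeq

lemma lt_rowLen_iff (κ : YoungDiagram) (i k : ℕ) : k < κ.rowLen i ↔ i < κ.colLen k := by
  rw [← YoungDiagram.mem_iff_lt_rowLen, ← YoungDiagram.mem_iff_lt_colLen]

lemma exists_first_pos {m : ℕ} (l : Fin m → ℕ) (h : l ≠ 0) :
    ∃ i, 0 < l i ∧ ∀ i' < i, l i' = 0 := by
  have hne : ∃ i, 0 < l i := by
    by_contra! hc
    exact h (funext fun i => Nat.le_zero.1 (hc i))
  obtain ⟨i, hi, hmin⟩ := WellFounded.has_min (wellFounded_lt (α := Fin m)) {i | 0 < l i} hne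
  exact ⟨i, hi, fun i' hi' => Nat.eq_zero_of_not_pos fun h => hmin i' h hi'⟩

lemma monotone_update_pred {m : ℕ} {l : Fin m → ℕ} (hl : Monotone l) {i : Fin m}
    (hi : ∀ i' < i, l i' = 0) : Monotone (Function.update l i (l i - 1)) := by
  intro x y hxy
  by_cases hx : x = i
  · subst hx
    rw [Function.update_self]
    by_cases hy : y = x
    · simp [hy]
    · rw [Function.update_of_ne hy]
      exact (Nat.sub_le _ _).trans (hl hxy)
  · rw [Function.update_of_ne hx]
    by_cases hy : y = i
    · subst hy
      rw [hi x (lt_of_le_of_ne hxy hx)]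
      exact Nat.zero_le _
    · rw [Function.update_of_ne hy]
      exact hl hxy

lemma sum_update_pred_lt {m : ℕ} {l : Fin m → ℕ} {i : Fin m} (hi : 0 < l i) :
    ∑ x, Function.update l i (l i - 1) x < ∑ x, l x := by
  refine Finset.sum_lt_sum (fun x _ => ?_) ⟨i, Finset.mem_univ _, ?_⟩
  · by_cases hx : x = i
    · subst hx
      simp
    · rw [Function.update_of_ne hx]
  · rw [Function.update_self]
    omega

lemma update_pred_le {m : ℕ} {l : Fin m → ℕ} (i x : Fin m) :
    Function.update l i (l i - 1) x ≤ l x := by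
  by_cases hx : x = i
  · subst hx
    simp
  · rw [Function.update_of_ne hx]

lemma count_update_of_ne {m : ℕ} (l : Fin m → ℕ) (i : Fin m) {k c : ℕ} (hc : c ≠ k)
    (hl : l i = k + 1) :
    (Finset.univ.filter fun x : Fin m => c < Function.update l i k x).card =
      (Finset.univ.filter fun x : Fin m => c < l x).card := by
  congr 1
  ext x
  simp only [Finset.mem_filter, Finset.mem_univ, true_and]
  by_cases hx : x = i
  · subst hx
    rw [Function.update_self]
    omega
  · rw [Function.update_of_ne hx]

lemma filter_lt_first {m : ℕ} {l : Fin m → ℕ} (hl : Monotone l) {i : Fin m}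
    (h0 : ∀ i' < i, l i' = 0) {k : ℕ} (hk : l i = k + 1) :
    (Finset.univ.filter fun x : Fin m => k < l x) = Finset.Ici i := by
  ext x
  simp only [Finset.mem_filter, Finset.mem_univ, true_and, Finset.mem_Ici]
  constructor
  · intro h
    by_contra hx
    rw [h0 x (not_le.1 hx)] at h
    omega
  · intro h
    have := hl h
    omega

lemma filter_lt_update_first {m : ℕ} {l : Fin m → ℕ} (hl : Monotone l) {i : Fin m}
    (h0 : ∀ i' < i, l i' = 0) {k : ℕ} (hk : l i = k + 1) :
    (Finset.univ.filter fun x : Fin m => k < Function.update l i k x) = Finset.Ioi i := by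
  ext x
  simp only [Finset.mem_filter, Finset.mem_univ, true_and, Finset.mem_Ioi]
  by_cases hx : x = i
  · simp [hx]
  · rw [Function.update_of_ne hx]
    constructor
    · intro h
      by_contra hc
      rw [h0 x (lt_of_le_of_ne (not_lt.1 hc) hx)] at h
      omega
    · intro h
      have := hl h.le
      omega

lemma sub_count_first {m : ℕ} {l : Fin m → ℕ} (hl : Monotone l) {i : Fin m}
    (h0 : ∀ i' < i, l i' = 0) {k : ℕ} (hk : l i = k + 1) :
    m - (Finset.univ.filter fun x : Fin m => k < l x).card = i := by
  rw [filter_lt_first hl h0 hk, Fin.card_Ici]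
  omega

lemma sub_count_update_first {m : ℕ} {l : Fin m → ℕ} (hl : Monotone l) {i : Fin m}
    (h0 : ∀ i' < i, l i' = 0) {k : ℕ} (hk : l i = k + 1) :
    m - (Finset.univ.filter fun x : Fin m => k < Function.update l i k x).card = i + 1 := by
  rw [filter_lt_update_first hl h0 hk, Fin.card_Ioi]
  omega

/-- The highest weight of `(V_κ)^*` with respect to a decreasing Borel subalgebra
(truncated subtraction is meant). -/
def dualWeight {m N : ℕ} (κ : YoungDiagram) (b : DESeq m N) : Fin m ⊕ Fin N → ℂ :=
  Sum.elim (fun i => -((κ.rowLen i - b.ell i : ℕ) : ℂ))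
    (fun k => -((κ.colLen k - (m - b.jay k) : ℕ) : ℂ))

lemma dualWeight_flip {m N : ℕ} (κ : YoungDiagram) {b b' : DESeq m N} (hb : b.IsDecreasing)
    (hb' : b'.IsDecreasing) {i : Fin m} {k : Fin N} (h0 : ∀ i' < i, b'.ell i' = 0)
    (hk : b'.ell i = k + 1) (h : b.ell = Function.update b'.ell i k) :
    dualWeight κ b' =
      if dualWeight κ b (Sum.inr k) + dualWeight κ b (Sum.inl i) = 0 then dualWeight κ b
      else dualWeight κ b - (Pi.single (Sum.inr k) 1 - Pi.single (Sum.inl i) 1) := by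
  have hek : b.ell i = k := by rw [h, Function.update_self]
  have hj' : m - b'.jay k = i := by
    rw [hb'.jay_eq]
    exact sub_count_first hb'.ell_mono h0 hk
  have hj : m - b.jay k = i + 1 := by
    rw [hb.jay_eq, h]
    exact sub_count_update_first hb'.ell_mono h0 hk
  have hiff := lt_rowLen_iff κ i k
  have e1 : dualWeight κ b (Sum.inr k) = -((κ.colLen k - (i + 1) : ℕ) : ℂ) := by
    simp only [dualWeight, Sum.elim_inr, hj]
  have e2 : dualWeight κ b (Sum.inl i) = -((κ.rowLen i - k : ℕ) : ℂ) := by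
    simp only [dualWeight, Sum.elim_inl, hek]
  have e1' : dualWeight κ b' (Sum.inr k) = -((κ.colLen k - i : ℕ) : ℂ) := by
    simp only [dualWeight, Sum.elim_inr, hj']
  have e2' : dualWeight κ b' (Sum.inl i) = -((κ.rowLen i - (k + 1) : ℕ) : ℂ) := by
    simp only [dualWeight, Sum.elim_inl, hk]
  have f1 : ∀ x, x ≠ k → dualWeight κ b' (Sum.inr x) = dualWeight κ b (Sum.inr x) := by
    intro x hx
    simp only [dualWeight, Sum.elim_inr]
    rw [hb'.jay_eq, hb.jay_eq, h, count_update_of_ne _ _ (by simpa [Fin.ext_iff] using hx) hk]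
  have f2 : ∀ x, x ≠ i → dualWeight κ b' (Sum.inl x) = dualWeight κ b (Sum.inl x) := by
    intro x hx
    simp only [dualWeight, Sum.elim_inl]
    rw [h, Function.update_of_ne hx]
  have hcond : dualWeight κ b (Sum.inr k) + dualWeight κ b (Sum.inl i) = 0 ↔
      ¬(k : ℕ) < κ.rowLen i := by
    rw [e1, e2, ← neg_add, neg_eq_zero, ← Nat.cast_add, Nat.cast_eq_zero]
    omega
  split_ifs with hc
  · rw [hcond] at hc
    funext p
    rcases p with x | x
    · by_cases hx : x = i
      · subst hx
        rw [e2', e2, show κ.rowLen x - (k + 1) = κ.rowLen x - k by omega]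
      · exact f2 x hx
    · by_cases hx : x = k
      · subst hx
        rw [e1', e1, show κ.colLen x - i = κ.colLen x - (i + 1) by omega]
      · exact f1 x hx
  · rw [hcond, not_not] at hc
    funext p
    rcases p with x | x
    · by_cases hx : x = i
      · subst hx
        rw [Pi.sub_apply, e2', e2, show κ.rowLen x - k = κ.rowLen x - (k + 1) + 1 by omega]
        simp
      · simp [f2 x hx, hx]
    · by_cases hx : x = k
      · subst hx
        rw [Pi.sub_apply, e1', e1, show κ.colLen x - i = κ.colLen x - (i + 1) + 1 by omega]
        simp
        ring
      · simp [f1 x hx, hx]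

lemma Supermodule.IsHWVector.congr {m N : ℕ} {V : Type*} [AddCommGroup V] [Module ℂ V]
    {ρ : Supermodule m N V} {b b' : DESeq m N} {ν : Fin m ⊕ Fin N → ℂ} {v : V}
    (hv : ρ.IsHWVector b ν v) (h : ∀ p q, b'.pos p < b'.pos q → b.pos p < b.pos q) :
    ρ.IsHWVector b' ν v :=
  ⟨hv.ne_zero, hv.weight, fun p q hpq => hv.nil p q (h p q hpq)⟩

/-- The highest weights of `(V_κ)^*` with respect to the decreasing Borel subalgebras. -/
lemma Supermodule.IsIrreducible.exists_dualWeight {m N : ℕ} {V : Type*} [AddCommGroup V]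
    [Module ℂ V] [FiniteDimensional ℂ V] {ρ : Supermodule m N V} (hρ : ρ.IsIrreducible)
    {κ : YoungDiagram} (hκ : ρ.IsHighestWeight (DESeq.standard m N) (hookWeight m N κ))
    {b : DESeq m N} (hb : b.IsDecreasing) : ∃ f, ρ.dual.IsHWVector b (dualWeight κ b) f := by
  induction hs : ∑ i, b.ell i using Nat.strong_induction_on generalizing b with
  | _ s ih =>
  by_cases h0 : b.ell = 0
  · obtain ⟨f, hf⟩ := hρ.exists_dual_hwVector DESeq.opposite_pos_lt hκ
    have hw : dualWeight κ b = -hookWeight m N κ := by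
      funext p
      rcases p with i | k
      · simp [dualWeight, hookWeight, h0]
      · simp [dualWeight, hookWeight, h0, hb.jay_eq]
    refine ⟨f, hw ▸ hf.congr fun p q => ?_⟩
    rw [hb.pos_lt_iff DESeq.opposite_isDecreasing (h0.trans DESeq.ell_opposite.symm)]
    exact id
  · obtain ⟨i, hi, hmin⟩ := exists_first_pos b.ell h0
    have hlN : b.ell i - 1 < N := by
      have := b.ell_le i
      omega
    set k : Fin N := ⟨b.ell i - 1, hlN⟩ with hk
    have hk1 : b.ell i = k + 1 := by
      rw [hk]
      exact (Nat.sub_add_cancel hi).symm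
    have hmono := monotone_update_pred hb.ell_mono hmin
    have hle : ∀ x, Function.update b.ell i (b.ell i - 1) x ≤ N :=
      fun x => (update_pred_le i x).trans (b.ell_le x)
    set b₁ := DESeq.ofEll _ hmono hle with hb₁
    have hdec : b₁.IsDecreasing := DESeq.ofEll_isDecreasing _ _ _
    have hell : b₁.ell = Function.update b.ell i k := DESeq.ell_ofEll _ _ _
    obtain ⟨f, hf⟩ := ih _ (by rw [← hs, hell]; exact sum_update_pred_lt hi) hdec rfl
    have hflip : b₁.Flip b (Sum.inr k) (Sum.inl i) := by
      refine hdec.flip hb (by rw [hell, Function.update_self]) ?_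
      rw [hell, Function.update_idem, ← hk1, Function.update_eq_self]
    rw [dualWeight_flip κ hdec hb hmin hk1 hell]
    exact hρ.dual.oddReflection (by simp [parity]) hflip hf

end CapelliGL

namespace CapelliGL

open Matrix

namespace DESeq

variable {m N : ℕ}

lemma weyl_apply (b : DESeq m N) (p : Fin m ⊕ Fin N) :
    b.weyl p = 1 / 2 * ∑ q, (if parity p = parity q then (1 : ℂ) else -1) *
      ((if b.pos p < b.pos q then 1 else 0) - (if b.pos q < b.pos p then 1 else 0)) := by
  have h1 : ∀ r : Fin m ⊕ Fin N, (∑ q ∈ Finset.univ.filter (fun q => b.pos r < b.pos q),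
      (if parity r = parity q then (1 : ℂ) else -1) • (Pi.single r 1 - Pi.single q 1 :
        Fin m ⊕ Fin N → ℂ)) p =
      (if p = r then ∑ q, (if parity p = parity q then (1 : ℂ) else -1) *
        (if b.pos p < b.pos q then 1 else 0) else 0) -
      (if parity p = parity r then (1 : ℂ) else -1) * (if b.pos r < b.pos p then 1 else 0) := by
    intro r
    rw [Finset.sum_apply, Finset.sum_filter]
    have h2 : ∀ q, (if b.pos r < b.pos q then ((if parity r = parity q then (1 : ℂ) else -1) •
        (Pi.single r 1 - Pi.single q 1 : Fin m ⊕ Fin N → ℂ)) p else 0) =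
        (if p = r then (if parity p = parity q then (1 : ℂ) else -1) *
          (if b.pos p < b.pos q then 1 else 0) else 0) -
        (if q = p then (if parity p = parity r then (1 : ℂ) else -1) *
          (if b.pos r < b.pos p then 1 else 0) else 0) := by
      intro q
      rw [Pi.smul_apply, Pi.sub_apply, Pi.single_apply, Pi.single_apply]
      by_cases hr : p = r
      · subst hr
        by_cases hq : q = p
        · subst hq
          simp
        · simp [hq, Ne.symm hq]
      · by_cases hq : q = p
        · subst hq
          by_cases hlt : b.pos r < b.pos q <;> simp [hr, hlt, eq_comm (a := parity r)]
        · simp [hr, hq, Ne.symm hq]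
    rw [Finset.sum_congr rfl fun q _ => h2 q, Finset.sum_sub_distrib, Finset.sum_ite_eq']
    by_cases hr : p = r <;> simp [hr]
  rw [weyl, Pi.smul_apply, Finset.sum_apply, Finset.sum_congr rfl fun r _ => h1 r,
    Finset.sum_sub_distrib, Finset.sum_ite_eq, if_pos (Finset.mem_univ _),
    ← Finset.sum_sub_distrib, smul_eq_mul]
  simp only [mul_sub]

lemma sum_ite_lt_sub (n : ℕ) (i : Fin n) :
    ∑ j : Fin n, ((if j < i then (1 : ℂ) else 0) - (if i < j then 1 else 0)) = 2 * i + 1 - n := by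
  rw [Finset.sum_sub_distrib, Finset.sum_boole, Finset.sum_boole]
  have h1 : (Finset.univ.filter fun j : Fin n => j < i) = Finset.Iio i := by ext; simp
  have h2 : (Finset.univ.filter fun j : Fin n => i < j) = Finset.Ioi i := by ext; simp
  rw [h1, h2, Fin.card_Iio, Fin.card_Ioi]
  have h : ((n - 1 - i : ℕ) : ℂ) = n - 1 - i := by
    have := i.2
    rw [Nat.cast_sub (by omega), Nat.cast_sub (by omega), Nat.cast_one]
  rw [h]
  ring

lemma sum_ite_sub_not {ι : Type*} [Fintype ι] (P : ι → Prop) [DecidablePred P] :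
    ∑ j, ((if P j then (1 : ℂ) else 0) - (if ¬P j then 1 else 0)) =
      2 * (Finset.univ.filter P).card - Fintype.card ι := by
  have h : ∀ j, (if P j then (1 : ℂ) else 0) - (if ¬P j then 1 else 0) =
      2 * (if P j then 1 else 0) - 1 := by
    intro j
    by_cases hj : P j <;> simp [hj]
    norm_num
  rw [Finset.sum_congr rfl fun j _ => h j, Finset.sum_sub_distrib, ← Finset.mul_sum,
    Finset.sum_boole]
  simp

lemma IsDecreasing.weyl_inl {b : DESeq m N} (hb : b.IsDecreasing) (i : Fin m) :
    b.weyl (Sum.inl i) = (2 * i + 1 - m) / 2 + N / 2 - b.ell i := by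
  have h1 := sum_ite_lt_sub m i
  have h2 := sum_ite_sub_not fun k : Fin N => (k : ℕ) < b.ell i
  rw [card_fin_lt N _ (b.ell_le i), Fintype.card_fin] at h2
  rw [weyl_apply, Fintype.sum_sum_type]
  simp only [hb.inl_lt_inl, hb.inl_lt_inr, hb.inr_lt_inl, parity, Sum.elim_inl, Sum.elim_inr,
    if_true, zero_ne_one, if_false, ← Finset.mul_sum, h1, h2]
  ring

lemma IsDecreasing.weyl_inr {b : DESeq m N} (hb : b.IsDecreasing) (k : Fin N) :
    b.weyl (Sum.inr k) = (2 * k + 1 - N) / 2 - m / 2 + b.jay k := by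
  have h1 := sum_ite_lt_sub N k
  have h2 := sum_ite_sub_not fun i : Fin m => (k : ℕ) < b.ell i
  rw [← hb.jay_eq, Fintype.card_fin] at h2
  have h3 : ∑ i : Fin m, ((if ¬(k : ℕ) < b.ell i then (1 : ℂ) else 0) -
      (if (k : ℕ) < b.ell i then 1 else 0)) = -(2 * b.jay k - m) := by
    rw [← h2, ← Finset.sum_neg_distrib]
    simp only [neg_sub]
  rw [weyl_apply, Fintype.sum_sum_type]
  simp only [hb.inr_lt_inr, hb.inl_lt_inr, hb.inr_lt_inl, parity, Sum.elim_inl, Sum.elim_inr,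
    if_true, one_ne_zero, if_false, ← Finset.mul_sum, h1, h3]
  ring

end DESeq

/-! ### The even case -/

/-- `M₀ (ν_b + ρ_b)` for the highest weight `ν_b` of `W_lam` and `ℓ_{i,b} = 2 a_i`. -/
noncomputable def coreVec {m : ℕ} (n : ℕ) (lam : YoungDiagram) (a : Fin m → ℕ) :
    Fin m ⊕ Fin n → ℂ :=
  Sum.elim (fun i => ((max (lam.rowLen i) (a i) : ℕ) : ℂ) - (2 * i + 1 - m) / 4 - n / 2)
    (fun k => ((max (lam.colLen k) (m - (Finset.univ.filter fun i : Fin m => k < a i).card) :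
      ℕ) : ℂ) - (2 * k + 1 - n + m / 2))

lemma coreVec_update {m n : ℕ} (lam : YoungDiagram) {a : Fin m → ℕ} (ha : Monotone a) {i : Fin m}
    (h0 : ∀ i' < i, a i' = 0) {k : Fin n} (hk : a i = k + 1) :
    MonoidallyEquivalent (1 / 2) (coreVec n lam a) (coreVec n lam (Function.update a i k)) := by
  have hiff := lt_rowLen_iff lam i k
  have hJ := sub_count_first ha h0 hk
  have hJ' := sub_count_update_first ha h0 hk
  set a' := Function.update a i k with ha'
  have f1 : ∀ x, x ≠ k → coreVec n lam a (Sum.inr x) = coreVec n lam a' (Sum.inr x) := by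
    intro x hx
    simp only [coreVec, Sum.elim_inr]
    rw [ha', count_update_of_ne _ _ (by simpa [Fin.ext_iff] using hx) hk]
  have f2 : ∀ x, x ≠ i → coreVec n lam a (Sum.inl x) = coreVec n lam a' (Sum.inl x) := by
    intro x hx
    simp only [coreVec, Sum.elim_inl]
    rw [ha', Function.update_of_ne hx]
  have e1 : coreVec n lam a (Sum.inr k) =
      ((max (lam.colLen k) i : ℕ) : ℂ) - (2 * k + 1 - n + m / 2) := by
    simp only [coreVec, Sum.elim_inr, hJ]
  have e1' : coreVec n lam a' (Sum.inr k) =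
      ((max (lam.colLen k) (i + 1) : ℕ) : ℂ) - (2 * k + 1 - n + m / 2) := by
    simp only [coreVec, Sum.elim_inr, hJ']
  have e2 : coreVec n lam a (Sum.inl i) =
      ((max (lam.rowLen i) (k + 1) : ℕ) : ℂ) - (2 * i + 1 - m) / 4 - n / 2 := by
    simp only [coreVec, Sum.elim_inl, hk]
  have e2' : coreVec n lam a' (Sum.inl i) =
      ((max (lam.rowLen i) k : ℕ) : ℂ) - (2 * i + 1 - m) / 4 - n / 2 := by
    simp only [coreVec, Sum.elim_inl, ha', Function.update_self]
  by_cases hc : (k : ℕ) < lam.rowLen i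
  · have : coreVec n lam a = coreVec n lam a' := by
      funext p
      rcases p with x | x
      · by_cases hx : x = i
        · subst hx
          rw [e2, e2', max_eq_left (by omega), max_eq_left (by omega)]
        · exact f2 x hx
      · by_cases hx : x = k
        · subst hx
          rw [e1, e1', max_eq_left (by omega), max_eq_left (by omega)]
        · exact f1 x hx
    rw [this]
    exact Relation.EqvGen.refl _
  · rw [max_eq_right (by omega)] at e1 e1' e2 e2'
    push_cast at e1' e2
    set w : Fin m ⊕ Fin n → ℂ :=
      coreVec n lam a' + Pi.single (Sum.inl i) (1 / 2) - Pi.single (Sum.inr k) (1 / 2) with hw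
    have hstep := SymmetryStep.monoidal (θ := 1 / 2) w i k (by
      simp [hw, e1', e2']
      ring)
    have g1 : coreVec n lam a = w + Pi.single (Sum.inl i) (1 / 2) - Pi.single (Sum.inr k) (1 / 2) := by
      funext p
      rcases p with x | x
      · by_cases hx : x = i
        · subst hx
          simp [hw, e2, e2']
          ring
        · simp [hw, f2 x hx, hx]
      · by_cases hx : x = k
        · subst hx
          simp [hw, e1, e1']
          ring
        · simp [hw, f1 x hx, hx]
    have g2 : coreVec n lam a' =
        w - Pi.single (Sum.inl i) (1 / 2) + Pi.single (Sum.inr k) (1 / 2) := by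
      rw [hw]
      abel
    rw [← g1, ← g2] at hstep
    exact Relation.EqvGen.rel _ _ hstep

lemma coreVec_equiv_zero {m n : ℕ} (lam : YoungDiagram) {a : Fin m → ℕ} (ha : Monotone a)
    (hn : ∀ i, a i ≤ n) :
    MonoidallyEquivalent (1 / 2) (coreVec n lam a) (coreVec n lam 0) := by
  induction hs : ∑ i, a i using Nat.strong_induction_on generalizing a with
  | _ s ih =>
  by_cases h0 : a = 0
  · rw [h0]
    exact Relation.EqvGen.refl _
  · obtain ⟨i, hi, hmin⟩ := exists_first_pos a h0
    have := hn i
    have h1 := coreVec_update (n := n) lam ha hmin (k := ⟨a i - 1, by omega⟩)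
      (Nat.sub_add_cancel hi).symm
    exact h1.trans _ _ _ (ih _ (by rw [← hs]; exact sum_update_pred_lt hi)
      (monotone_update_pred ha hmin) (fun x => (update_pred_le i x).trans (hn x)) rfl)

lemma colLen_doubled (lam : YoungDiagram) (k : ℕ) :
    (doubled lam).colLen k = lam.colLen (k / 2) := by
  refine eq_of_forall_lt_iff fun c => ?_
  rw [← YoungDiagram.mem_iff_lt_colLen, mem_doubled, YoungDiagram.mem_iff_lt_colLen]

lemma sum_fin_two_mul {n : ℕ} (g : Fin (2 * n) → ℂ) :
    ∑ K, g K = ∑ k : Fin n, (g (dOdd k) + g (dEven k)) := by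
  rw [Finset.sum_add_distrib]
  have h : Function.Bijective (Sum.elim dOdd dEven : Fin n ⊕ Fin n → Fin (2 * n)) := by
    rw [Fintype.bijective_iff_injective_and_card]
    refine ⟨?_, by simp; omega⟩
    rintro (x | x) (y | y) hxy <;> simp [dOdd, dEven, Fin.ext_iff] at hxy ⊢ <;> omega
  rw [← (Equiv.ofBijective _ h).sum_comp, Fintype.sum_sum_type]
  rfl

lemma M₀_mulVec_inl {m n : ℕ} (x : Fin m ⊕ Fin (2 * n) → ℂ) (i : Fin m) :
    (M₀ m n *ᵥ x) (Sum.inl i) = -(x (Sum.inl i) / 2) := by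
  rw [Matrix.mulVec, dotProduct, Fintype.sum_sum_type]
  simp [M₀, Matrix.one_apply]
  ring

lemma M₀_mulVec_inr {m n : ℕ} (x : Fin m ⊕ Fin (2 * n) → ℂ) (k : Fin n) :
    (M₀ m n *ᵥ x) (Sum.inr k) = -((x (Sum.inr (dOdd k)) + x (Sum.inr (dEven k))) / 2) := by
  rw [Matrix.mulVec, dotProduct, Fintype.sum_sum_type, sum_fin_two_mul]
  have h : ∀ k' : Fin n,
      M₀ m n (Sum.inr k) (Sum.inr (dOdd k')) * x (Sum.inr (dOdd k')) +
        M₀ m n (Sum.inr k) (Sum.inr (dEven k')) * x (Sum.inr (dEven k')) =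
      if k = k' then -((x (Sum.inr (dOdd k)) + x (Sum.inr (dEven k))) / 2) else 0 := by
    intro k'
    have h1 : (dOdd k' = dOdd k ∨ dOdd k' = dEven k) ↔ k = k' := by
      simp only [dOdd, dEven, Fin.ext_iff]
      omega
    have h2 : (dEven k' = dOdd k ∨ dEven k' = dEven k) ↔ k = k' := by
      simp only [dOdd, dEven, Fin.ext_iff]
      omega
    simp only [M₀, Matrix.fromBlocks_apply₂₂, Matrix.of_apply, h1, h2]
    split_ifs with h
    · subst h
      ring
    · ring
  rw [Finset.sum_congr rfl fun k' _ => h k', Finset.sum_ite_eq, if_pos (Finset.mem_univ _)]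
  simp [M₀]

lemma cast_sub_add_self (x y : ℕ) : ((x - y : ℕ) : ℂ) = ((max x y : ℕ) : ℂ) - y := by
  rw [eq_sub_iff_add_eq, ← Nat.cast_add]
  congr 1
  omega

lemma M₀_mulVec_dualWeight_add {m n : ℕ} (lam : YoungDiagram) {b : DESeq m (2 * n)}
    (hb : b.IsDecreasing) {a : Fin m → ℕ} (ha : ∀ i, b.ell i = 2 * a i) :
    M₀ m n *ᵥ dualWeight (doubled lam) b + M₀ m n *ᵥ b.weyl = coreVec n lam a := by
  funext p
  rcases p with i | k
  · rw [Pi.add_apply, M₀_mulVec_inl, M₀_mulVec_inl, hb.weyl_inl]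
    simp only [dualWeight, coreVec, Sum.elim_inl, rowLen_doubled, ha, ← Nat.mul_sub,
      Nat.cast_mul, cast_sub_add_self]
    push_cast
    ring
  · have hj : ∀ K : Fin (2 * n), (K : ℕ) / 2 = k →
        b.jay K = (Finset.univ.filter fun i : Fin m => (k : ℕ) < a i).card := by
      intro K hK
      rw [hb.jay_eq]
      congr 1
      ext i
      simp only [Finset.mem_filter, Finset.mem_univ, true_and, ha]
      omega
    have hk1 : ((dOdd k : Fin (2 * n)) : ℕ) / 2 = k := by simp only [dOdd]; omega
    have hk2 : ((dEven k : Fin (2 * n)) : ℕ) / 2 = k := by simp only [dEven]; omega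
    have hle := DESeq.count_le a k
    rw [Pi.add_apply, M₀_mulVec_inr, M₀_mulVec_inr, hb.weyl_inr, hb.weyl_inr]
    simp only [dualWeight, coreVec, Sum.elim_inr, colLen_doubled, hk1, hk2, hj _ hk1, hj _ hk2,
      cast_sub_add_self]
    rw [max_eq_left hle]
    simp only [dOdd, dEven]
    push_cast
    ring

end CapelliGL

namespace CapelliGL

open Matrix

namespace DESeq

variable {m n : ℕ}

lemma evenPart_isDecreasing {N : ℕ} (b : DESeq m N) (hb : b.IsDecreasing) :
    (b.evenPart hb).IsDecreasing := ofEll_isDecreasing _ _ _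

lemma ell_evenPart {N : ℕ} (b : DESeq m N) (hb : b.IsDecreasing) (i : Fin m) :
    (b.evenPart hb).ell i = 2 * (b.ell i / 2) :=
  congrFun (ell_ofEll _ _ _) i

lemma IsDecreasing.jay_dEven_le {b : DESeq m (2 * n)} (hb : b.IsDecreasing) (k : Fin n) :
    b.jay (dEven k) ≤ b.jay (dOdd k) := by
  rw [hb.jay_eq, hb.jay_eq]
  exact count_anti _ (by simp [dEven, dOdd])

lemma jay_evenPart_dOdd (b : DESeq m (2 * n)) (hb : b.IsDecreasing) (k : Fin n) :
    (b.evenPart hb).jay (dOdd k) = b.jay (dEven k) := by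
  rw [(b.evenPart_isDecreasing hb).jay_eq, hb.jay_eq]
  congr 1
  ext i
  simp only [Finset.mem_filter, Finset.mem_univ, true_and, ell_evenPart]
  simp only [dOdd, dEven]
  omega

lemma jay_evenPart_dEven (b : DESeq m (2 * n)) (hb : b.IsDecreasing) (k : Fin n) :
    (b.evenPart hb).jay (dEven k) = b.jay (dEven k) := by
  rw [(b.evenPart_isDecreasing hb).jay_eq, hb.jay_eq]
  congr 1
  ext i
  simp only [Finset.mem_filter, Finset.mem_univ, true_and, ell_evenPart]
  simp only [dEven]
  omega

lemma IsDecreasing.mem_T_of_ell {b : DESeq m (2 * n)} (hb : b.IsDecreasing) {i : Fin m}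
    {k : Fin n} (h : b.ell i = 2 * k + 1) : k ∈ b.T := by
  have h1 := (sub_count_le_iff hb.ell_mono i (dOdd k : Fin (2 * n))).2 (by simp [dOdd, h])
  have h2 := mt (sub_count_le_iff hb.ell_mono i (dEven k : Fin (2 * n))).1 (by simp [dEven, h])
  rw [← hb.jay_eq] at h1 h2
  change b.jay (dEven k) < b.jay (dOdd k)
  omega

lemma IsDecreasing.rOdd_inl {b : DESeq m (2 * n)} (hb : b.IsDecreasing) (k : Fin n) (i : Fin m) :
    b.rOdd k (Sum.inl i) = if b.ell i = 2 * k + 1 then -1 else 0 := by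
  have h1 := sub_count_le_iff hb.ell_mono i (dOdd k : Fin (2 * n))
  have h2 := sub_count_le_iff hb.ell_mono i (dEven k : Fin (2 * n))
  rw [← hb.jay_eq] at h1 h2
  have h3 : (m - b.jay (dOdd k) + 1 ≤ (i : ℕ) + 1 ∧ (i : ℕ) + 1 ≤ m - b.jay (dEven k)) ↔
      b.ell i = 2 * k + 1 := by
    simp only [dOdd, dEven] at h1 h2 ⊢
    omega
  rw [rOdd, Pi.sub_apply, Finset.sum_apply, Finset.sum_filter]
  simp only [Pi.smul_apply, Pi.single_apply, reduceCtorEq, if_false, smul_zero, Sum.inl.injEq]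
  rw [Finset.sum_eq_single i]
  · simp only [h3, if_true]
    split_ifs <;> simp
  · intro x _ hx
    simp [Ne.symm hx]
  · simp

lemma rOdd_inr (b : DESeq m (2 * n)) (k : Fin n) (K : Fin (2 * n)) :
    b.rOdd k (Sum.inr K) =
      if K = dOdd k then (b.jay (dOdd k) : ℂ) - (b.jay (dEven k) : ℂ) else 0 := by
  rw [rOdd, Pi.sub_apply, Finset.sum_apply, Finset.sum_eq_zero, sub_zero]
  · simp [Pi.single_apply]
  · intro x _
    simp

lemma r_inl (b : DESeq m (2 * n)) (i : Fin m) : b.r (Sum.inl i) = -(b.ell i : ℂ) := by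
  rw [r, Finset.sum_apply, Finset.sum_eq_single i]
  · rw [Finset.sum_apply, Finset.sum_congr rfl (g := fun _ => (-1 : ℂ)) (by simp)]
    rw [Finset.sum_const, card_fin_lt _ _ (b.ell_le i)]
    simp
  · intro x _ hx
    rw [Finset.sum_apply]
    exact Finset.sum_eq_zero fun k _ => by simp [Ne.symm hx]
  · simp

end DESeq

open DESeq

/-- The columns of a compatible partition avoid the open intervals `(m - j_{2k-1}, m - j_{2k})`. -/
lemma colLen_of_isCompatible {m n : ℕ} {b : DESeq m (2 * n)} (hb : b.IsDecreasing)
    (lam : YoungDiagram)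
    (h : b.IsCompatible lam (dualWeight (doubled lam) (opposite m (2 * n)))
      (dualWeight (doubled lam) b)) {k : Fin n} (hk : k ∈ b.T) :
    m - b.jay (dEven k) ≤ lam.colLen k ∨ lam.colLen k ≤ m - b.jay (dOdd k) := by
  have hlt : b.jay (dEven k) < b.jay (dOdd k) := hk
  have hle := hb.jay_le (dOdd k)
  rcases h with h | h
  · left
    set i : Fin m := ⟨m - b.jay (dEven k) - 1, by omega⟩ with hi
    have h1 := sub_count_le_iff hb.ell_mono i (dOdd k : Fin (2 * n))
    rw [← hb.jay_eq] at h1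
    have h2 := h1.1 (by simp only [hi]; omega)
    have h3 := congrFun h (Sum.inl i)
    rw [Pi.sub_apply, r_inl] at h3
    simp only [dualWeight, Sum.elim_inl, ell_opposite, Pi.zero_apply, Nat.sub_zero,
      rowLen_doubled] at h3
    have h4 : 2 * lam.rowLen i = (2 * lam.rowLen i - b.ell i) + b.ell i := by
      rw [← Nat.cast_inj (R := ℂ), Nat.cast_add]
      linear_combination h3
    have h5 := lt_rowLen_iff lam i k
    simp only [dOdd] at h2
    have h6 := h5.1 (by omega)
    simp only [hi] at h6
    omega
  · rcases h k hk with h | h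
    · left
      have := (lt_rowLen_iff lam (m - b.jay (dEven k) - 1) k).1 (by omega)
      omega
    · right
      have := mt (lt_rowLen_iff lam (m - b.jay (dOdd k)) k).2 (by omega)
      omega

lemma dualWeight_evenPart {m n : ℕ} {b : DESeq m (2 * n)} (hb : b.IsDecreasing)
    (lam : YoungDiagram) (h : ∀ k ∈ b.T,
      m - b.jay (dEven k) ≤ lam.colLen k ∨ lam.colLen k ≤ m - b.jay (dOdd k)) :
    ∃ S : Finset (Fin n), (∀ k ∈ S, k ∈ b.T) ∧
      dualWeight (doubled lam) (b.evenPart hb) = dualWeight (doubled lam) b + ∑ k ∈ S, b.rOdd k := by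
  classical
  refine ⟨Finset.univ.filter fun k => k ∈ b.T ∧ m - b.jay (dEven k) ≤ lam.colLen k,
    fun k hk => (Finset.mem_filter.1 hk).2.1, ?_⟩
  funext p
  rcases p with i | K
  · rw [Pi.add_apply, Finset.sum_apply, Finset.sum_filter]
    simp only [dualWeight, Sum.elim_inl, rowLen_doubled, ell_evenPart, hb.rOdd_inl]
    rcases Nat.even_or_odd' (b.ell i) with ⟨c, hc | hc⟩
    · rw [Finset.sum_eq_zero, add_zero, show 2 * (b.ell i / 2) = b.ell i by omega]
      intro k _
      rw [if_neg (show ¬b.ell i = 2 * k + 1 by omega), ite_self]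
    · have hcn : c < n := by
        have := b.ell_le i
        omega
      have hT := hb.mem_T_of_ell (k := ⟨c, hcn⟩) hc
      rw [Finset.sum_eq_single ⟨c, hcn⟩]
      · have h1 := sub_count_le_iff hb.ell_mono i (dOdd ⟨c, hcn⟩ : Fin (2 * n))
        have h2 := sub_count_le_iff hb.ell_mono i (dEven ⟨c, hcn⟩ : Fin (2 * n))
        rw [← hb.jay_eq] at h1 h2
        have h3 := lt_rowLen_iff lam i c
        have h4 := h _ hT
        rw [if_pos hc]
        by_cases h5 : m - b.jay (dEven ⟨c, hcn⟩) ≤ lam.colLen c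
        · rw [if_pos ⟨hT, h5⟩]
          simp only [dOdd, dEven] at h1 h2 h4 h5
          rw [show 2 * lam.rowLen i - 2 * (b.ell i / 2) = 2 * lam.rowLen i - b.ell i + 1 by omega]
          push_cast
          ring
        · rw [if_neg fun h => h5 h.2, add_zero]
          simp only [dOdd, dEven] at h1 h2 h4 h5
          rw [show 2 * lam.rowLen i - 2 * (b.ell i / 2) = 2 * lam.rowLen i - b.ell i by omega]
      · intro k _ hk
        rw [if_neg (c := b.ell i = 2 * k + 1), ite_self]
        intro hk'
        exact hk (Fin.ext (by simp only; omega))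
      · simp
  · rw [Pi.add_apply, Finset.sum_apply, Finset.sum_filter]
    simp only [dualWeight, Sum.elim_inr, colLen_doubled, rOdd_inr]
    have hkn : (K : ℕ) / 2 < n := by
      have := K.2
      omega
    obtain ⟨k, hk⟩ : ∃ k : Fin n, k = ⟨(K : ℕ) / 2, hkn⟩ := ⟨_, rfl⟩
    have hkv : (K : ℕ) / 2 = k := by rw [hk]
    rcases Nat.even_or_odd' (K : ℕ) with ⟨c, hc | hc⟩
    · obtain rfl : K = dOdd k := Fin.ext (by simp only [dOdd]; omega)
      rw [Finset.sum_eq_single k, jay_evenPart_dOdd, hkv, if_pos rfl]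
      · have hT : k ∈ b.T ↔ b.jay (dEven k) < b.jay (dOdd k) := Iff.rfl
        have h4 := h k
        have hle := hb.jay_dEven_le k
        have hle' := hb.jay_le (dOdd k)
        split_ifs with h5
        · rw [show lam.colLen k - (m - b.jay (dOdd k)) =
            lam.colLen k - (m - b.jay (dEven k)) + (b.jay (dOdd k) - b.jay (dEven k)) by omega,
            Nat.cast_add, Nat.cast_sub hle]
          ring
        · rw [add_zero]
          congr 2
          by_cases hT' : b.jay (dEven k) < b.jay (dOdd k)
          · have h6 := h4 hT'
            rw [hT] at h5
            omega
          · rw [show b.jay (dEven k) = b.jay (dOdd k) by omega]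
      · intro k' _ hk'
        rw [if_neg (c := dOdd k = dOdd k'), ite_self]
        intro he
        exact hk' (Fin.ext (by simp only [dOdd, Fin.ext_iff] at he; omega))
      · simp
    · obtain rfl : K = dEven k := Fin.ext (by simp only [dEven]; omega)
      rw [Finset.sum_eq_zero, jay_evenPart_dEven, add_zero]
      intro k' _
      rw [if_neg (c := dEven k = dOdd k'), ite_self]
      simp only [dOdd, dEven, Fin.ext_iff]
      omega

lemma mulVec_eq_of_mem_setC {m n : ℕ} {M : Matrix (Fin m ⊕ Fin n) (Fin m ⊕ Fin (2 * n)) ℂ}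
    (hM : M ∈ setC m n) {y : Fin m ⊕ Fin (2 * n) → ℂ}
    (hy : ∀ k, y (Sum.inr (dEven k)) = y (Sum.inr (dOdd k))) : M *ᵥ y = M₀ m n *ᵥ y := by
  obtain ⟨A, hA, rfl⟩ := hM
  rw [Matrix.add_mulVec, add_eq_left]
  funext s
  rw [Matrix.mulVec, dotProduct, Fintype.sum_sum_type, sum_fin_two_mul]
  simp [hA, hy]

lemma tau_dualWeight {m n : ℕ} {b : DESeq m (2 * n)} (hb : b.IsDecreasing)
    {M : Matrix (Fin m ⊕ Fin n) (Fin m ⊕ Fin (2 * n)) ℂ} (hM : M ∈ b.setC) (lam : YoungDiagram)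
    (h : b.IsCompatible lam (dualWeight (doubled lam) (opposite m (2 * n)))
      (dualWeight (doubled lam) b)) :
    b.tau hb M (dualWeight (doubled lam) b) = coreVec n lam fun i => b.ell i / 2 := by
  obtain ⟨S, hS, hy⟩ := dualWeight_evenPart hb lam fun k hk => colLen_of_isCompatible hb lam h hk
  have h1 : M *ᵥ dualWeight (doubled lam) (b.evenPart hb) =
      M *ᵥ dualWeight (doubled lam) b := by
    rw [hy, Matrix.mulVec_add, Matrix.mulVec_sum, Finset.sum_eq_zero fun k hk => hM.2 k (hS k hk),
      add_zero]
  have h2 : M *ᵥ dualWeight (doubled lam) (b.evenPart hb) =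
      M₀ m n *ᵥ dualWeight (doubled lam) (b.evenPart hb) := by
    refine mulVec_eq_of_mem_setC hM.1 fun k => ?_
    simp only [dualWeight, Sum.elim_inr, colLen_doubled, jay_evenPart_dEven, jay_evenPart_dOdd]
    congr 4
    simp only [dEven, dOdd]
    omega
  rw [tau, ← h1, h2]
  exact M₀_mulVec_dualWeight_add lam (b.evenPart_isDecreasing hb) fun i => b.ell_evenPart hb i

end CapelliGL

theorem mainTheorem6 {m n : ℕ} (b : CapelliGL.DESeq m (2 * n)) (hb : b.IsDecreasing)
    (M : Matrix (Fin m ⊕ Fin n) (Fin m ⊕ Fin (2 * n)) ℂ) (hM : M ∈ b.setC)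
    (lam : YoungDiagram) (hlam : CapelliGL.IsHook m n lam)
    {V : Type*} [AddCommGroup V] [Module ℂ V] [FiniteDimensional ℂ V]
    (ρ : CapelliGL.Supermodule m (2 * n) V) (hirr : ρ.IsIrreducible)
    (hV : ρ.IsHighestWeight (CapelliGL.DESeq.standard m (2 * n)) (CapelliGL.hookWeight m (2 * n) (CapelliGL.doubled lam))) :
    (∃! ν₀, ρ.dual.IsHighestWeight (CapelliGL.DESeq.opposite m (2 * n)) ν₀) ∧
    (∃! ν, ρ.dual.IsHighestWeight b ν) ∧
    ∀ ν₀ ν, ρ.dual.IsHighestWeight (CapelliGL.DESeq.opposite m (2 * n)) ν₀ → ρ.dual.IsHighestWeight b ν →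
      b.IsCompatible lam ν₀ ν →
      CapelliGL.MonoidallyEquivalent (1 / 2) (b.tau hb M ν) (CapelliGL.tau₀ m n ν₀) := by
  have hex : ∀ {b : CapelliGL.DESeq m (2 * n)}, b.IsDecreasing → ∃ f,
      ρ.dual.IsHWVector b (CapelliGL.dualWeight (CapelliGL.doubled lam) b) f :=
    fun hb => hirr.exists_dualWeight hV hb
  have huniq : ∀ {b : CapelliGL.DESeq m (2 * n)}, b.IsDecreasing →
      ∀ ν, ρ.dual.IsHighestWeight b ν → ν = CapelliGL.dualWeight (CapelliGL.doubled lam) b := by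
    intro b hb ν hν
    obtain ⟨f, hf⟩ := hex hb
    obtain ⟨g, hg⟩ := (ρ.dual.isHighestWeight_iff b ν).1 hν
    exact hirr.dual.highestWeight_unique hf hg
  have hopp := CapelliGL.DESeq.opposite_isDecreasing (m := m) (N := 2 * n)
  refine ⟨⟨_, (ρ.dual.isHighestWeight_iff _ _).2 (hex hopp), huniq hopp⟩,
    ⟨_, (ρ.dual.isHighestWeight_iff _ _).2 (hex hb), huniq hb⟩, ?_⟩
  intro ν₀ ν hν₀ hν hcomp
  obtain rfl := huniq hopp ν₀ hν₀
  obtain rfl := huniq hb ν hν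
  have h0 : CapelliGL.tau₀ m n (CapelliGL.dualWeight (CapelliGL.doubled lam)
      (CapelliGL.DESeq.opposite m (2 * n))) = CapelliGL.coreVec n lam 0 :=
    CapelliGL.M₀_mulVec_dualWeight_add lam hopp fun i => by rw [CapelliGL.DESeq.ell_opposite]; rfl
  rw [CapelliGL.tau_dualWeight hb hM lam hcomp, h0]
  refine CapelliGL.coreVec_equiv_zero lam (fun i i' h => Nat.div_le_div_right (hb.ell_mono h))
    fun i => ?_
  have := b.ell_le i
  omega
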